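/- Notation. $\zeta$ is the Riemann zeta function, $\zeta'$ its derivative, and $L(s,\chi)$ is the Dirichlet $L$-function of $\chi$ (in each case the analytic continuation). For a Dirichlet character $\chi$ modulo $q$, $\bar\chi$ is its complex conjugate, $\tau(\bar\chi)=\sum_{a \bmod q}\bar\chi(a)e^{2\pi i a/q}$ is a Gauss sum, and for an integer $j\ge 0$ put $S_j=\sum_{a=1}^{q-1}\bar\chi(a)a^j$ and $T_j=\sum_{a=1}^{q-1}\bar\chi(a)a^j\log a$. Put $H_n=\sum_{j=1}^n \frac1j$ (so $H_0=0$). All infinite series below converge absolutely. (I) For every integer $m\ge 1$, $$\zeta(2m+1)=\frac{(-1)^m\pi^{2m}\log 2}{(2^{-2m}-2)(2m)!}+\frac{(-1)^m\,2\pi^{2m}}{(2m)!\,(2^{-2m}-2)}\left\{\frac12H_{2m}+\sum_{k=0}^{m-1}2^{2k}\binom{2m}{2k}\zeta'(-2k)+\sum_{k\ge1}\frac{(2k-1)!\,(2m)!}{(2m+2k)!}\zeta(2k)2^{-2k}\right\}.$$ (II) Let $q\ge2$ be an integer, $\chi$ an even primitive character modulo $q$, and $m\ge0$ an integer. Then $$L(2m+1,\chi)=\frac{(-1)^m2^{2m}\pi^{2m}}{(2m)!\,\tau(\bar\chi)}\,q^{-2m}\left\{S_{2m}\log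 q-T_{2m}\right\}$$ $$+\frac{(-1)^m2^{2m+1}\pi^{2m}}{(2m)!\,\tau(\bar\chi)}\left\{\sum_{k=0}^{m-1}q^{2k-2m}\binom{2m}{2k}\zeta'(-2k)S_{2m-2k}+\frac{q^{-2m}}2H_{2m}S_{2m}+\sum_{k\ge1}\frac{(2k-1)!\,(2m)!}{(2m+2k)!}\zeta(2k)q^{-2m-2k}S_{2m+2k}\right\}.$$ (III) Let $q\ge2$ be an integer, $\chi$ an odd primitive character modulo $q$, and $m\ge1$ an integer. Then $$L(2m,\chi)=\frac{i(-1)^{m+1}2^{2m-1}\pi^{2m-1}}{\tau(\bar\chi)\,(2m-1)!}\,q^{1-2m}\left\{-T_{2m-1}+S_{2m-1}\log q\right\}$$ $$+\frac{i(-1)^{m+1}2^{2m}\pi^{2m-1}}{\tau(\bar\chi)\,(2m-1)!}\left\{\sum_{k=0}^{m-1}q^{2k+1-2m}\binom{2m-1}{2k}\zeta'(-2k)S_{2m-1-2k}+\frac{q^{1-2m}}2H_{2m-1}S_{2m-1}+\sum_{k\ge1}\frac{(2k-1)!\,(2m-1)!}{(2m+2k-1)!}\zeta(2k)q^{1-2m-2k}S_{2m+2k-1}\right\}.$$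 -/

import Mathlib

open scoped Nat

/-- The character sum `∑ χ̄(a) a ^ j` over `1 ≤ a < q`. -/
noncomputable def conjPowerSum {q : ℕ} (χ : DirichletCharacter ℂ q) (j : ℕ) : ℂ :=
  ∑ a ∈ Finset.Ico 1 q, starRingEnd ℂ (χ (a : ZMod q)) * (a : ℂ) ^ j

/-- The character sum `∑ χ̄(a) a ^ j log a` over `1 ≤ a < q`. -/
noncomputable def conjLogPowerSum {q : ℕ} (χ : DirichletCharacter ℂ q) (j : ℕ) : ℂ :=
  ∑ a ∈ Finset.Ico 1 q, starRingEnd ℂ (χ (a : ZMod q)) * (a : ℂ) ^ j * (Real.log a : ℂ)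

/-- The Gauss sum `τ(χ̄) = ∑ χ̄(a) exp (2 π i a / q)`, over `a` modulo `q`. -/
noncomputable def conjGaussSum {q : ℕ} [NeZero q] (χ : DirichletCharacter ℂ q) : ℂ :=
  gaussSum (star χ) (ZMod.stdAddChar (N := q))

/-- The partial sum `∑ 1 / j` over `1 ≤ j ≤ n` of the harmonic series. -/
noncomputable def harmonicSum (n : ℕ) : ℂ :=
  ∑ j ∈ Finset.Icc 1 n, 1 / (j : ℂ)

/-- The coefficient `(2k-1)! n! / (n+2k)! * ζ(2k)`, used for `k ≥ 1` only. -/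
noncomputable def zetaCoeff (n k : ℕ) : ℂ :=
  ((2 * k - 1)! : ℂ) * (n ! : ℂ) / ((n + 2 * k)! : ℂ) * riemannZeta (2 * (k : ℂ))

/-! Put C_0(x) = -log(2 sin πx) and, for N ≥ 1, C_N(x) = ∑ cos(2πnx - πN/2) / ((2π)^N n^(N+1)). The
phase makes C_(N+1)' = C_N on (0,1). Euler's sine product gives C_0(x) = -log x - log 2π + ∑ ζ(2k)
x^(2k) / k over k ≥ 1. Integrating N times from 0 turns this into x^N/N! (H_N - log x), plus a
polynomial built from the values C_j(0), plus a power series in the ζ(2k) (`clausen_eq`). The C_j(0)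
with j odd vanish, and the functional equation identifies C_(2k)(0) with 2 ζ'(-2k) / (2k)!
(`clausenConst_even`).

For primitive χ the discrete Fourier transform of χ̄ is a multiple of χ, so τ(χ̄) L(s, χ) is a
combination of periodic zeta functions at the points a/q (`conjGaussSum_mul_LFunction`). Parity
keeps only the cosine or the sine part, which at the relevant integer s is an explicit multiple of
C_N(a/q). Inserting the expansion gives both character formulas; for even χ the constant term
disappears because ∑ χ̄(a) = 0.

The zeta formula is the case x = 1/2: C_(2m)(1/2) and the constant term are both multiples of
ζ(2m+1), and the relation is solved for it.

Absolute convergence fails at two places: C_1' = C_0 is obtained by Abel summation, and the value of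
the cosine zeta function at s = 1, needed for L(1, χ), by a Mellin integral. -/

open Filter Topology HurwitzZeta

/-! ### The power series of log sin, from Euler's product -/

/-- The real number `ζ (2 k + 2)`, as a series. -/
noncomputable def evenZeta (k : ℕ) : ℝ := ∑' n : ℕ, 1 / ((n : ℝ) + 1) ^ (2 * k + 2)

lemma summable_evenZeta (k : ℕ) : Summable fun n : ℕ => 1 / ((n : ℝ) + 1) ^ (2 * k + 2) := by
  have := (summable_nat_add_iff 1).2
    (Real.summable_one_div_nat_pow (p := 2 * k + 2) |>.2 (by omega))
  simpa using this

lemma evenZeta_nonneg (k : ℕ) : 0 ≤ evenZeta k := tsum_nonneg fun n => by positivity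

lemma evenZeta_le (k : ℕ) : evenZeta k ≤ evenZeta 0 := by
  refine (summable_evenZeta k).tsum_le_tsum (fun n => ?_) (summable_evenZeta 0)
  apply one_div_le_one_div_of_le (by positivity)
  exact pow_le_pow_right₀ (by linarith [(Nat.cast_nonneg n : (0 : ℝ) ≤ n)]) (by omega)

lemma sin_pi_mul_pos {x : ℝ} (h0 : 0 < x) (h1 : x < 1) : 0 < Real.sin (Real.pi * x) :=
  Real.sin_pos_of_pos_of_lt_pi (by positivity) (by nlinarith [Real.pi_pos])

lemma sq_div_succ_sq_lt_one {x : ℝ} (h0 : 0 < x) (h1 : x < 1) (n : ℕ) :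
    x ^ 2 / ((n : ℝ) + 1) ^ 2 < 1 := by
  rw [div_lt_one (by positivity)]
  exact pow_lt_pow_left₀ (by linarith [(Nat.cast_nonneg n : (0 : ℝ) ≤ n)]) h0.le two_ne_zero

/-- Logarithm of Euler's sine product. The terms are nonnegative, so convergence of the partial sums
is enough. -/
lemma hasSum_neg_log_one_sub_sq_div {x : ℝ} (h0 : 0 < x) (h1 : x < 1) :
    HasSum (fun n : ℕ => -Real.log (1 - x ^ 2 / ((n : ℝ) + 1) ^ 2))
      (Real.log (Real.pi * x) - Real.log (Real.sin (Real.pi * x))) := by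
  have hlt := sq_div_succ_sq_lt_one h0 h1
  have hpos : ∀ n : ℕ, 0 ≤ x ^ 2 / ((n : ℝ) + 1) ^ 2 := fun n => by positivity
  have hpx : 0 < Real.pi * x := by positivity
  rw [hasSum_iff_tendsto_nat_of_nonneg fun n =>
    neg_nonneg.2 (Real.log_nonpos (by linarith [hlt n]) (by linarith [hpos n]))]
  have h := ((Real.continuousAt_log (sin_pi_mul_pos h0 h1).ne').tendsto.comp
    (Real.tendsto_euler_sin_prod x)).const_sub (Real.log (Real.pi * x))
  refine h.congr fun n => ?_
  have hne : ∀ j ∈ Finset.range n, 1 - x ^ 2 / ((j : ℝ) + 1) ^ 2 ≠ 0 := fun j _ => by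
    linarith [hlt j]
  simp only [Function.comp_apply]
  rw [Real.log_mul hpx.ne' (Finset.prod_ne_zero_iff.2 hne), Real.log_prod hne,
    Finset.sum_neg_distrib]
  ring

/-- The power series of `log (sin (π x) / (π x))`. -/
lemma hasSum_log_sin {x : ℝ} (h0 : 0 < x) (h1 : x < 1) :
    HasSum (fun k : ℕ => evenZeta k * (x ^ (2 * k + 2) / (k + 1)))
      (Real.log (Real.pi * x) - Real.log (Real.sin (Real.pi * x))) := by
  -- Each logarithm is expanded in powers of x². Rows of this double series sum to the logarithms of
  -- the Euler factors, columns to multiples of ζ(2k+2); nonnegativity permits the exchange.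
  set F : ℕ × ℕ → ℝ := fun p => (x ^ 2 / ((p.1 : ℝ) + 1) ^ 2) ^ (p.2 + 1) / (p.2 + 1)
  have hrow : ∀ n : ℕ, HasSum (fun k => F (n, k)) (-Real.log (1 - x ^ 2 / ((n : ℝ) + 1) ^ 2)) :=
    fun n => by
      have h := sq_div_succ_sq_lt_one h0 h1 n
      have h' : |x ^ 2 / ((n : ℝ) + 1) ^ 2| < 1 := by rwa [abs_of_nonneg (by positivity)]
      have := Real.hasSum_pow_div_log_of_abs_lt_one h'
      simpa only [F] using this
  have hL := hasSum_neg_log_one_sub_sq_div h0 h1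
  have hs : Summable F := by
    refine (summable_prod_of_nonneg fun p => ?_).2 ⟨fun n => (hrow n).summable, ?_⟩
    · simp only [Pi.zero_apply, F]; positivity
    · simpa only [(hrow _).tsum_eq] using hL.summable
  have htot : HasSum F (Real.log (Real.pi * x) - Real.log (Real.sin (Real.pi * x))) := by
    have h : HasSum (fun n : ℕ => -Real.log (1 - x ^ 2 / ((n : ℝ) + 1) ^ 2)) (∑' p, F p) :=
      HasSum.prod_fiberwise hs.hasSum hrow
    rw [hL.unique h]
    exact hs.hasSum
  have hswap : HasSum (F ∘ Equiv.prodComm ℕ ℕ)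
      (Real.log (Real.pi * x) - Real.log (Real.sin (Real.pi * x))) :=
    (Equiv.prodComm ℕ ℕ).hasSum_iff.2 htot
  refine HasSum.prod_fiberwise hswap fun k => ?_
  refine ((summable_evenZeta k).hasSum.mul_right (x ^ (2 * k + 2) / ((k : ℝ) + 1))).congr_fun
    fun n => ?_
  simp only [Function.comp_apply, Equiv.prodComm_apply, Prod.swap, F, div_pow, ← pow_mul]
  rw [show 2 * (k + 1) = 2 * k + 2 by ring]
  ring

/-! ### The functions C_N and termwise differentiation -/

/-- The series `∑ cos (2 π n x - π N / 2) / ((2 π) ^ N n ^ (N + 1))` for `N ≥ 1`,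
and `-log (2 sin (π x))` for `N = 0`. -/
noncomputable def clausen (N : ℕ) (x : ℝ) : ℝ :=
  if N = 0 then -Real.log (2 * Real.sin (Real.pi * x))
  else ∑' n : ℕ, Real.cos (2 * Real.pi * n * x - Real.pi * N / 2) /
    ((2 * Real.pi) ^ N * (n : ℝ) ^ (N + 1))

lemma summable_clausen_bound {N : ℕ} (hN : N ≠ 0) :
    Summable fun n : ℕ => 1 / ((2 * Real.pi) ^ N * (n : ℝ) ^ (N + 1)) := by
  have := (Real.summable_one_div_nat_pow (p := N + 1) |>.2 (by omega)).mul_left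
    (1 / (2 * Real.pi) ^ N)
  refine this.congr fun n => ?_
  rw [one_div_mul_one_div]

lemma norm_clausen_term_le (N n : ℕ) (t : ℝ) :
    ‖Real.cos t / ((2 * Real.pi) ^ N * (n : ℝ) ^ (N + 1))‖ ≤
      1 / ((2 * Real.pi) ^ N * (n : ℝ) ^ (N + 1)) := by
  rw [norm_div, Real.norm_of_nonneg (by positivity : 0 ≤ (2 * Real.pi) ^ N * (n : ℝ) ^ (N + 1))]
  gcongr
  exact Real.abs_cos_le_one t

lemma summable_clausen {N : ℕ} (hN : N ≠ 0) (x : ℝ) :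
    Summable fun n : ℕ => Real.cos (2 * Real.pi * n * x - Real.pi * N / 2) /
      ((2 * Real.pi) ^ N * (n : ℝ) ^ (N + 1)) :=
  .of_norm_bounded (summable_clausen_bound hN) fun n => norm_clausen_term_le N n _

lemma continuous_clausen {N : ℕ} (hN : N ≠ 0) : Continuous (clausen N) := by
  unfold clausen
  simp only [hN, if_false]
  exact continuous_tsum (fun n => by fun_prop) (summable_clausen_bound hN)
    fun n x => norm_clausen_term_le N n _

/-- The phase shift by π/2 absorbs the sign and the change from cosine to sine, so differentiation
only lowers N. -/
lemma hasDerivAt_clausen_term (N n : ℕ) (x : ℝ) :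
    HasDerivAt (fun x : ℝ => Real.cos (2 * Real.pi * n * x - Real.pi * (N + 1 : ℕ) / 2) /
      ((2 * Real.pi) ^ (N + 1) * (n : ℝ) ^ (N + 1 + 1)))
      (Real.cos (2 * Real.pi * n * x - Real.pi * N / 2) /
        ((2 * Real.pi) ^ N * (n : ℝ) ^ (N + 1))) x := by
  have h1 : HasDerivAt (fun x : ℝ => 2 * Real.pi * n * x - Real.pi * (N + 1 : ℕ) / 2)
      (2 * Real.pi * n) x := by
    simpa using ((hasDerivAt_id x).const_mul (2 * Real.pi * n)).sub_const
      (Real.pi * (N + 1 : ℕ) / 2)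
  refine (h1.cos.div_const ((2 * Real.pi) ^ (N + 1) * (n : ℝ) ^ (N + 1 + 1))).congr_deriv ?_
  have : 2 * Real.pi * n * x - Real.pi * (N + 1 : ℕ) / 2 =
      (2 * Real.pi * n * x - Real.pi * N / 2) - Real.pi / 2 := by
    push_cast; ring
  rw [this, Real.sin_sub_pi_div_two]
  -- The term n = 0 is zero on both sides, its denominator being 0.
  rcases eq_or_ne n 0 with rfl | hn
  · simp
  have := Real.pi_ne_zero
  field_simp
  ring

lemma hasDerivAt_clausen {N : ℕ} (hN : N ≠ 0) (x : ℝ) :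
    HasDerivAt (clausen (N + 1)) (clausen N x) x := by
  have := hasDerivAt_tsum (y₀ := 0) (summable_clausen_bound hN)
    (fun n y => hasDerivAt_clausen_term N n y)
    (fun n y => norm_clausen_term_le N n _) (summable_clausen N.succ_ne_zero 0) x
  unfold clausen
  simpa only [hN, N.succ_ne_zero, if_false] using! this

/-! ### Abel summation: the derivative of C_1 on (0,1) -/

lemma hasSum_pow_mul_cos_div {r : ℝ} (h0 : 0 ≤ r) (h1 : r < 1) (x : ℝ) :
    HasSum (fun n : ℕ => r ^ n * (Real.cos (2 * Real.pi * n * x) / n))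
      (-(Real.log ((1 - r) ^ 2 + 4 * r * Real.sin (Real.pi * x) ^ 2) / 2)) := by
  -- The series is the real part of -log(1 - z), that is, -log ‖1 - z‖.
  set z : ℂ := r * Complex.exp ((2 * Real.pi * x : ℝ) * Complex.I) with hz
  have hnz : ‖z‖ < 1 := by
    rw [hz, norm_mul, Complex.norm_exp_ofReal_mul_I, mul_one, Complex.norm_real,
      Real.norm_of_nonneg h0]
    exact h1
  have h := Complex.hasSum_re (Complex.hasSum_taylorSeries_neg_log hnz)
  have hn : ‖1 - z‖ ^ 2 = (1 - r) ^ 2 + 4 * r * Real.sin (Real.pi * x) ^ 2 := by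
    have hre : (1 - z).re = 1 - r * Real.cos (2 * Real.pi * x) := by
      rw [hz, Complex.sub_re, Complex.re_ofReal_mul, Complex.exp_ofReal_mul_I_re, Complex.one_re]
    have him : (1 - z).im = -(r * Real.sin (2 * Real.pi * x)) := by
      rw [hz, Complex.sub_im, Complex.im_ofReal_mul, Complex.exp_ofReal_mul_I_im, Complex.one_im,
        zero_sub]
    rw [← Complex.normSq_eq_norm_sq, Complex.normSq_apply, hre, him, mul_assoc,
      Real.sin_two_mul, Real.cos_two_mul]
    linear_combination (4 * r - 4 * r ^ 2 * Real.cos (Real.pi * x) ^ 2) *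
      (-Real.sin_sq_add_cos_sq (Real.pi * x))
  convert h using 1
  · funext n
    have : z ^ n / n = ((r ^ n / n : ℝ) : ℂ) *
        Complex.exp ((2 * Real.pi * n * x : ℝ) * Complex.I) := by
      rw [hz, mul_pow, ← Complex.exp_nat_mul]
      push_cast
      rw [show (n : ℂ) * (2 * Real.pi * x * Complex.I) = 2 * Real.pi * n * x * Complex.I by ring]
      ring
    rw [this, Complex.re_ofReal_mul, Complex.exp_ofReal_mul_I_re]
    ring
  · rw [Complex.neg_re, Complex.log_re, ← hn, Real.log_pow]
    push_cast
    ring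

/-- Abel means of the sine series `clausen 1`. -/
noncomputable def abelClausen (r x : ℝ) : ℝ :=
  ∑' n : ℕ, r ^ n * (Real.cos (2 * Real.pi * n * x - Real.pi * (1 : ℕ) / 2) /
    ((2 * Real.pi) ^ 1 * (n : ℝ) ^ (1 + 1)))

/-- For fixed r < 1 the geometric factor dominates the differentiated series, whose terms would
otherwise be only O(1/n). -/
lemma hasDerivAt_abelClausen {r : ℝ} (h0 : 0 ≤ r) (h1 : r < 1) (x : ℝ) :
    HasDerivAt (abelClausen r)
      (-(Real.log ((1 - r) ^ 2 + 4 * r * Real.sin (Real.pi * x) ^ 2) / 2)) x := by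
  rw [← (hasSum_pow_mul_cos_div h0 h1 x).tsum_eq]
  refine hasDerivAt_tsum (𝕜 := ℝ) (F := ℝ) (y₀ := 0) (summable_geometric_of_lt_one h0 h1)
    (g := fun (n : ℕ) (x : ℝ) => r ^ n * (Real.cos (2 * Real.pi * n * x - Real.pi * (1 : ℕ) / 2) /
      ((2 * Real.pi) ^ 1 * (n : ℝ) ^ (1 + 1))))
    (g' := fun n x => r ^ n * (Real.cos (2 * Real.pi * n * x) / n)) (fun n y => ?_) (fun n y => ?_) ?_ x
  · refine ((hasDerivAt_clausen_term 0 n y).const_mul (r ^ n)).congr_deriv ?_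
    simp
  · rw [norm_mul, Real.norm_of_nonneg (pow_nonneg h0 n)]
    refine mul_le_of_le_one_right (pow_nonneg h0 n) ?_
    rcases eq_or_ne n 0 with rfl | hn
    · simp
    have hn1 : (1 : ℝ) ≤ n := Nat.one_le_cast.2 (Nat.one_le_iff_ne_zero.2 hn)
    rw [norm_div, Real.norm_of_nonneg (by positivity : (0 : ℝ) ≤ n)]
    exact div_le_one_of_le₀ ((Real.abs_cos_le_one _).trans hn1) (by positivity)
  · refine .of_norm_bounded (summable_clausen_bound one_ne_zero) fun n => ?_
    rw [norm_mul, Real.norm_of_nonneg (pow_nonneg h0 n)]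
    exact (mul_le_of_le_one_left (norm_nonneg _) (pow_le_one₀ h0 h1.le)).trans
      (norm_clausen_term_le 1 n _)

lemma tendsto_abelClausen (x : ℝ) :
    Tendsto (fun r => abelClausen r x) (𝓝[<] 1) (𝓝 (clausen 1 x)) := by
  unfold clausen abelClausen
  simp only [one_ne_zero, if_false]
  refine tendsto_tsum_of_dominated_convergence (summable_clausen_bound one_ne_zero)
    (fun n => ?_) ?_
  · have : Tendsto (fun r : ℝ => r ^ n) (𝓝[<] 1) (𝓝 (1 ^ n)) :=
      ((continuous_pow n).tendsto 1).mono_left nhdsWithin_le_nhds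
    simpa only [one_pow, one_mul] using this.mul_const
      (Real.cos (2 * Real.pi * n * x - Real.pi * (1 : ℕ) / 2) /
        ((2 * Real.pi) ^ 1 * (n : ℝ) ^ (1 + 1)))
  · filter_upwards [Ioo_mem_nhdsLT (zero_lt_one' ℝ)] with r hr n
    rw [norm_mul, Real.norm_of_nonneg (pow_nonneg hr.1.le n)]
    exact (mul_le_of_le_one_left (norm_nonneg _) (pow_le_one₀ hr.1.le hr.2.le)).trans
      (norm_clausen_term_le 1 n _)

lemma clausen_zero (x : ℝ) : clausen 0 x = -Real.log (2 * Real.sin (Real.pi * x)) := if_pos rfl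

lemma continuousOn_clausen_zero : ContinuousOn (clausen 0) (Set.Ioo 0 1) := by
  rw [show clausen 0 = fun x => -Real.log (2 * Real.sin (Real.pi * x)) from funext clausen_zero]
  refine (ContinuousOn.log (by fun_prop) fun x hx => ?_).neg
  have := sin_pi_mul_pos hx.1 hx.2
  positivity

/-- The derivative of the Abel means is integrated over [a, b] and r tends to 1. The integrand is
continuous, hence bounded, on the compact set [1/2, 1] × [a, b], since the sine has no zero on [a,
b]; dominated convergence applies. -/
lemma clausen_one_sub {a b : ℝ} (ha : 0 < a) (hab : a ≤ b) (hb : b < 1) :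
    clausen 1 b - clausen 1 a = ∫ t in a..b, clausen 0 t := by
  have hpos : ∀ p ∈ Set.Icc (1 / 2 : ℝ) 1 ×ˢ Set.Icc a b,
      0 < (1 - p.1) ^ 2 + 4 * p.1 * Real.sin (Real.pi * p.2) ^ 2 := by
    rintro ⟨r, t⟩ ⟨hr, ht⟩
    have := sin_pi_mul_pos (ha.trans_le ht.1) (ht.2.trans_lt hb)
    have : (0 : ℝ) < r := by linarith [hr.1]
    positivity
  have hcont : ContinuousOn (fun p : ℝ × ℝ =>
      -(Real.log ((1 - p.1) ^ 2 + 4 * p.1 * Real.sin (Real.pi * p.2) ^ 2) / 2))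
      (Set.Icc (1 / 2 : ℝ) 1 ×ˢ Set.Icc a b) :=
    ((ContinuousOn.log (by fun_prop) fun p hp => (hpos p hp).ne').div_const 2).neg
  obtain ⟨C, hC⟩ := (isCompact_Icc.prod isCompact_Icc).exists_bound_of_continuousOn hcont
  have hslice : ∀ r ∈ Set.Icc (1 / 2 : ℝ) 1, ContinuousOn (fun t : ℝ =>
      -(Real.log ((1 - r) ^ 2 + 4 * r * Real.sin (Real.pi * t) ^ 2) / 2)) (Set.Icc a b) :=
    fun r hr => hcont.comp (f := fun t : ℝ => (r, t)) (by fun_prop) fun t ht => ⟨hr, ht⟩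
  have hmem : Set.Ioo (1 / 2 : ℝ) 1 ∈ 𝓝[<] (1 : ℝ) := Ioo_mem_nhdsLT (by norm_num)
  refine tendsto_nhds_unique ((tendsto_abelClausen b).sub (tendsto_abelClausen a)) ?_
  have hint : Tendsto (fun r : ℝ => ∫ t in a..b,
      -(Real.log ((1 - r) ^ 2 + 4 * r * Real.sin (Real.pi * t) ^ 2) / 2)) (𝓝[<] 1)
      (𝓝 (∫ t in a..b, clausen 0 t)) := by
    refine intervalIntegral.tendsto_integral_filter_of_dominated_convergence (fun _ => C) ?_ ?_
      intervalIntegrable_const ?_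
    · filter_upwards [hmem] with r hr
      rw [Set.uIoc_of_le hab]
      exact ((hslice r ⟨hr.1.le, hr.2.le⟩).mono Set.Ioc_subset_Icc_self).aestronglyMeasurable
        measurableSet_Ioc
    · filter_upwards [hmem] with r hr
      refine .of_forall fun t ht => ?_
      rw [Set.uIoc_of_le hab] at ht
      exact hC (r, t) ⟨⟨hr.1.le, hr.2.le⟩, Set.Ioc_subset_Icc_self ht⟩
    · refine .of_forall fun t ht => ?_
      rw [Set.uIoc_of_le hab] at ht
      have hs := sin_pi_mul_pos (ha.trans ht.1) (ht.2.trans_lt hb)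
      have hc : ContinuousAt (fun r : ℝ =>
          -(Real.log ((1 - r) ^ 2 + 4 * r * Real.sin (Real.pi * t) ^ 2) / 2)) 1 :=
        ((ContinuousAt.log (by fun_prop) (by positivity)).div_const 2).neg
      have hlim := hc.tendsto.mono_left (nhdsWithin_le_nhds (s := Set.Iio 1))
      convert hlim using 2
      rw [clausen_zero, show (1 - 1) ^ 2 + 4 * 1 * Real.sin (Real.pi * t) ^ 2 =
        (2 * Real.sin (Real.pi * t)) ^ 2 by ring, Real.log_pow]
      push_cast
      ring
  refine hint.congr' ?_
  filter_upwards [hmem] with r hr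
  refine intervalIntegral.integral_eq_sub_of_hasDerivAt
    (fun t _ => hasDerivAt_abelClausen (by linarith [hr.1]) hr.2 t) ?_
  refine ContinuousOn.intervalIntegrable ?_
  rw [Set.uIcc_of_le hab]
  exact hslice r ⟨hr.1.le, hr.2.le⟩

lemma hasDerivAt_clausen_one {x : ℝ} (h0 : 0 < x) (h1 : x < 1) :
    HasDerivAt (clausen 1) (clausen 0 x) x := by
  have hx2 : 0 < x / 2 := by positivity
  have hcont : ContinuousOn (clausen 0) (Set.uIcc (x / 2) x) := by
    rw [Set.uIcc_of_le (by linarith)]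
    exact continuousOn_clausen_zero.mono fun t ht => ⟨hx2.trans_le ht.1, ht.2.trans_lt h1⟩
  have hmeas := continuousOn_clausen_zero.stronglyMeasurableAtFilter isOpen_Ioo
    (μ := MeasureTheory.volume) x ⟨h0, h1⟩
  have h := (intervalIntegral.integral_hasDerivAt_right hcont.intervalIntegrable hmeas
    (continuousOn_clausen_zero.continuousAt (Ioo_mem_nhds h0 h1))).const_add (clausen 1 (x / 2))
  refine h.congr_of_eventuallyEq ?_
  filter_upwards [Ioo_mem_nhds (by linarith : x / 2 < x) h1] with y hy
  rw [← clausen_one_sub hx2 hy.1.le hy.2]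
  ring

/-! ### Expansion of C_N at 0 -/

lemma hasDerivAt_pow_div_factorial (n : ℕ) (x : ℝ) :
    HasDerivAt (fun x : ℝ => x ^ (n + 1) / ((n + 1)! : ℝ)) (x ^ n / (n ! : ℝ)) x := by
  refine ((hasDerivAt_pow (n + 1) x).div_const ((n + 1)! : ℝ)).congr_deriv ?_
  rw [Nat.factorial_succ, Nat.add_sub_cancel]
  push_cast
  have : (n ! : ℝ) ≠ 0 := by positivity
  have : (n : ℝ) + 1 ≠ 0 := by positivity
  field_simp

/-- The part `x ^ N / N ! * (H_N - log x)` of the expansion of `clausen N` at `0`. -/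
noncomputable def logPart (N : ℕ) (x : ℝ) : ℝ :=
  x ^ N / (N ! : ℝ) * (∑ j ∈ Finset.Icc 1 N, 1 / (j : ℝ) - Real.log x)

/-- The new harmonic term 1/(N+1) cancels what the derivative of -log x contributes. -/
lemma hasDerivAt_logPart (N : ℕ) {x : ℝ} (hx : 0 < x) :
    HasDerivAt (logPart (N + 1)) (logPart N x) x := by
  refine ((hasDerivAt_pow_div_factorial N x).mul
    ((Real.hasDerivAt_log hx.ne').const_sub _)).congr_deriv ?_
  rw [logPart, Finset.sum_Icc_succ_top (by omega), Nat.factorial_succ]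
  push_cast
  have : (N ! : ℝ) ≠ 0 := by positivity
  have : (N : ℝ) + 1 ≠ 0 := by positivity
  field_simp
  ring

/-- Continuity down to x = 0, where `clausen_eq` fixes its constant of integration; x log x extends
continuously. -/
lemma continuous_logPart (N : ℕ) : Continuous (logPart (N + 1)) := by
  have h : logPart (N + 1) = fun x => x ^ (N + 1) / ((N + 1)! : ℝ) *
      ∑ j ∈ Finset.Icc 1 (N + 1), 1 / (j : ℝ) - x ^ N / ((N + 1)! : ℝ) * (x * Real.log x) := by
    funext x
    rw [logPart]
    ring
  rw [h]
  have := Real.continuous_mul_log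
  fun_prop

/-- The constant term of the expansion of `clausen j` at `0`. -/
noncomputable def clausenConst (j : ℕ) : ℝ :=
  if j = 0 then -Real.log (2 * Real.pi) else clausen j 0

/-- The polynomial part of the expansion of `clausen N` at `0`. -/
noncomputable def polyPart (N : ℕ) (x : ℝ) : ℝ :=
  ∑ j ∈ Finset.range (N + 1), clausenConst j * (x ^ (N - j) / ((N - j)! : ℝ))

lemma hasDerivAt_polyPart (N : ℕ) (x : ℝ) :
    HasDerivAt (polyPart (N + 1)) (polyPart N x) x := by
  have h : polyPart (N + 1) = fun x => ∑ j ∈ Finset.range (N + 1),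
      clausenConst j * (x ^ (N - j + 1) / ((N - j + 1)! : ℝ)) + clausenConst (N + 1) := by
    funext x
    rw [polyPart, Finset.sum_range_succ _ (N + 1)]
    congr 1
    · refine Finset.sum_congr rfl fun j hj => ?_
      rw [Nat.sub_add_comm (Finset.mem_range_succ_iff.1 hj)]
    · simp
  rw [h]
  exact (HasDerivAt.fun_sum fun j _ => (hasDerivAt_pow_div_factorial (N - j) x).const_mul _).add_const _

lemma polyPart_succ_zero (N : ℕ) : polyPart (N + 1) 0 = clausen (N + 1) 0 := by
  rw [polyPart, Finset.sum_range_succ, Finset.sum_eq_zero fun j hj => ?_]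
  · simp [clausenConst]
  · rw [zero_pow (by have := Finset.mem_range.1 hj; omega)]
    simp

/-- The power series part of the expansion of `clausen N` at `0`, up to a factor `2`. -/
noncomputable def seriesPart (N : ℕ) (x : ℝ) : ℝ :=
  ∑' k : ℕ, evenZeta k * (2 * k + 1)! * (x ^ (2 * k + 2 + N) / ((2 * k + 2 + N)! : ℝ))

lemma norm_seriesPart_term_le (N k : ℕ) {x r : ℝ} (hr : |x| ≤ r) (hr1 : r ≤ 1) :
    ‖evenZeta k * (2 * k + 1)! * (x ^ (2 * k + 2 + N) / ((2 * k + 2 + N)! : ℝ))‖ ≤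
      evenZeta 0 * r ^ k := by
  have hr0 : 0 ≤ r := (abs_nonneg x).trans hr
  rw [mul_assoc, norm_mul, Real.norm_of_nonneg (evenZeta_nonneg k), mul_div_left_comm, norm_mul,
    Real.norm_of_nonneg (by positivity : 0 ≤ ((2 * k + 1)! : ℝ) / ((2 * k + 2 + N)! : ℝ)),
    norm_pow, Real.norm_eq_abs]
  refine mul_le_mul (evenZeta_le k) ?_ (by positivity) (evenZeta_nonneg 0)
  have h1 : ((2 * k + 1)! : ℝ) / ((2 * k + 2 + N)! : ℝ) ≤ 1 :=
    div_le_one_of_le₀ (Nat.cast_le.2 (Nat.factorial_le (by omega))) (by positivity)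
  calc _ ≤ |x| ^ (2 * k + 2 + N) := mul_le_of_le_one_right (by positivity) h1
    _ ≤ r ^ (2 * k + 2 + N) := pow_le_pow_left₀ (abs_nonneg x) hr _
    _ ≤ r ^ k := pow_le_pow_of_le_one hr0 hr1 (by omega)

lemma summable_seriesPart (N : ℕ) {x : ℝ} (hx : |x| < 1) :
    Summable fun k : ℕ =>
      evenZeta k * (2 * k + 1)! * (x ^ (2 * k + 2 + N) / ((2 * k + 2 + N)! : ℝ)) :=
  .of_norm_bounded ((summable_geometric_of_lt_one (abs_nonneg x) hx).mul_left _)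
    fun k => norm_seriesPart_term_le N k le_rfl hx.le

lemma hasDerivAt_seriesPart (N : ℕ) {x : ℝ} (hx : |x| < 1) :
    HasDerivAt (seriesPart (N + 1)) (seriesPart N x) x := by
  obtain ⟨r, hxr, hr1⟩ := exists_between hx
  have hr0 : 0 < r := (abs_nonneg x).trans_lt hxr
  refine hasDerivAt_tsum_of_isPreconnected (𝕜 := ℝ) (F := ℝ) (t := Set.Ioo (-r) r) (y₀ := 0)
    (g := fun (k : ℕ) (x : ℝ) => evenZeta k * (2 * k + 1)! *
      (x ^ (2 * k + 2 + (N + 1)) / ((2 * k + 2 + (N + 1))! : ℝ)))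
    (g' := fun (k : ℕ) (x : ℝ) => evenZeta k * (2 * k + 1)! *
      (x ^ (2 * k + 2 + N) / ((2 * k + 2 + N)! : ℝ)))
    ((summable_geometric_of_lt_one hr0.le hr1).mul_left (evenZeta 0))
    isOpen_Ioo isPreconnected_Ioo (fun k y _ => ?_) (fun k y hy => ?_) ⟨by linarith, hr0⟩ ?_
    (abs_lt.1 hxr)
  · exact (hasDerivAt_pow_div_factorial (2 * k + 2 + N) y).const_mul _
  · exact norm_seriesPart_term_le N k (abs_lt.2 hy).le hr1.le
  · exact summable_seriesPart (N + 1) (by simp)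

lemma seriesPart_zero (N : ℕ) : seriesPart N 0 = 0 := by
  simp [seriesPart]

/-- The expansion of the functions `clausen N` at `0`. -/
theorem clausen_eq (N : ℕ) {x : ℝ} (h0 : 0 < x) (h1 : x < 1) :
    clausen N x = logPart N x + polyPart N x + 2 * seriesPart N x := by
  induction N generalizing x with
  | zero =>
    -- Here (2k+1)!/(2k+2)! = 1/(2(k+1)), which is where the factor 2 in front of `seriesPart` comes
    -- from.
    have hs : seriesPart 0 x = (Real.log (Real.pi * x) - Real.log (Real.sin (Real.pi * x))) / 2 := by
      rw [← ((hasSum_log_sin h0 h1).div_const 2).tsum_eq, seriesPart]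
      refine tsum_congr fun k => ?_
      rw [add_zero, Nat.factorial_succ (2 * k + 1)]
      push_cast
      have : ((2 * k + 1)! : ℝ) ≠ 0 := by positivity
      have : (k : ℝ) + 1 ≠ 0 := by positivity
      have : (2 * (k : ℝ) + 1 + 1) ≠ 0 := by positivity
      field_simp
      ring
    rw [hs, clausen_zero, Real.log_mul two_ne_zero (sin_pi_mul_pos h0 h1).ne',
      Real.log_mul Real.pi_ne_zero h0.ne']
    simp only [logPart, polyPart, clausenConst, zero_add, Finset.range_one, Finset.sum_singleton,
      if_true, pow_zero, Nat.factorial_zero, Nat.cast_one, Nat.sub_self,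
      Real.log_mul two_ne_zero Real.pi_ne_zero]
    simp
    ring
  | succ N ih =>
    -- The difference of the two sides has zero derivative on (0, x), is continuous on [0, x] and
    -- vanishes at 0, so it vanishes at x by the mean value theorem.
    set D : ℝ → ℝ := fun x =>
      clausen (N + 1) x - (logPart (N + 1) x + polyPart (N + 1) x + 2 * seriesPart (N + 1) x)
    have hderiv : ∀ t ∈ Set.Ioo 0 x, HasDerivAt D 0 t := by
      intro t ht
      have ht1 := ht.2.trans h1
      have hc : HasDerivAt (clausen (N + 1)) (clausen N t) t := by
        rcases eq_or_ne N 0 with rfl | hN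
        · exact hasDerivAt_clausen_one ht.1 ht1
        · exact hasDerivAt_clausen hN t
      refine (hc.sub (((hasDerivAt_logPart N ht.1).add (hasDerivAt_polyPart N t)).add
        ((hasDerivAt_seriesPart N (abs_lt.2 ⟨by linarith [ht.1], ht1⟩)).const_mul 2))).congr_deriv ?_
      rw [ih ht.1 ht1]
      ring
    have hcont : ContinuousOn D (Set.Icc 0 x) := by
      have hp : Continuous (polyPart (N + 1)) :=
        continuous_iff_continuousAt.2 fun t => (hasDerivAt_polyPart N t).continuousAt
      have hs : ContinuousOn (seriesPart (N + 1)) (Set.Icc 0 x) := fun t ht =>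
        (hasDerivAt_seriesPart N
          (abs_lt.2 ⟨by linarith [ht.1], ht.2.trans_lt h1⟩)).continuousAt.continuousWithinAt
      exact (continuous_clausen N.succ_ne_zero).continuousOn.sub
        (((continuous_logPart N).add hp).continuousOn.add (hs.const_smul (2 : ℝ)))
    obtain ⟨c, -, hc⟩ := exists_hasDerivAt_eq_slope D (fun _ => 0) h0 hcont hderiv
    have hD : D x = D 0 := by
      rw [sub_zero, eq_div_iff h0.ne'] at hc
      linarith
    have hD0 : D 0 = 0 := by
      simp only [D, polyPart_succ_zero, seriesPart_zero, logPart]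
      simp
    rw [hD0] at hD
    linarith

/-! ### Mellin transform and the value of the periodic zeta function at s = 1 -/

/-- The function `t ↦ z exp (-t) / (1 - z exp (-t))`. -/
noncomputable def bosonKernel (z : ℂ) (t : ℝ) : ℂ :=
  z * Complex.exp (-t) / (1 - z * Complex.exp (-t))

section
variable {z : ℂ}

lemma norm_mul_exp_neg_le (hz : ‖z‖ = 1) (t : ℝ) :
    ‖z * Complex.exp (-t)‖ = Real.exp (-t) := by
  rw [norm_mul, hz, one_mul, Complex.norm_exp]
  simp

/-- The real part stays positive, so the principal logarithm is smooth along the whole path,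
including t = 0. -/
lemma one_sub_mem_slitPlane (hre : z.re < 1) {t : ℝ} (ht : 0 ≤ t) :
    1 - z * Complex.exp (-t) ∈ Complex.slitPlane := by
  refine Or.inl ?_
  have h1 : Real.exp (-t) ≤ 1 := Real.exp_le_one_iff.2 (by linarith)
  have h0 := Real.exp_pos (-t)
  have : (z * Complex.exp (-t)).re = z.re * Real.exp (-t) := by
    rw [← Complex.ofReal_neg, ← Complex.ofReal_exp, Complex.re_mul_ofReal]
  rw [Complex.sub_re, Complex.one_re, this]
  nlinarith

lemma hasDerivAt_log_one_sub (hre : z.re < 1) {t : ℝ} (ht : 0 ≤ t) :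
    HasDerivAt (fun t : ℝ => Complex.log (1 - z * Complex.exp (-t))) (bosonKernel z t) t := by
  have h : HasDerivAt (fun t : ℝ => 1 - z * Complex.exp (-t)) (z * Complex.exp (-t)) t := by
    have h1 : HasDerivAt (fun t : ℝ => -(t : ℂ)) (-1) t := (Complex.ofRealCLM.hasDerivAt).neg
    simpa using (h1.cexp.const_mul z).const_sub 1
  exact h.clog_real (one_sub_mem_slitPlane hre ht)

lemma continuousOn_bosonKernel (hre : z.re < 1) :
    ContinuousOn (bosonKernel z) (Set.Ici 0) := by
  refine ContinuousOn.div (by fun_prop) (by fun_prop) fun t ht => ?_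
  exact Complex.slitPlane_ne_zero (one_sub_mem_slitPlane hre ht)

lemma bosonKernel_isBigO_atTop (hz : ‖z‖ = 1) :
    bosonKernel z =O[atTop] fun t => Real.exp (-1 * t) := by
  refine Asymptotics.IsBigO.of_bound 2 ?_
  filter_upwards [eventually_ge_atTop (1 : ℝ)] with t ht
  have h2 : Real.exp (-t) ≤ 1 / 2 := by
    rw [Real.exp_neg, one_div]
    exact inv_anti₀ two_pos (by linarith [Real.add_one_le_exp t])
  have h3 : 1 / 2 ≤ ‖1 - z * Complex.exp (-t)‖ := by
    have := norm_sub_norm_le 1 (z * Complex.exp (-t))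
    rw [norm_one, norm_mul_exp_neg_le hz] at this
    linarith
  rw [bosonKernel, norm_div, norm_mul_exp_neg_le hz, neg_one_mul,
    Real.norm_of_nonneg (Real.exp_nonneg _), div_le_iff₀ (by linarith)]
  nlinarith [Real.exp_pos (-t)]

lemma bosonKernel_isBigO_zero (hre : z.re < 1) :
    bosonKernel z =O[𝓝[>] 0] fun t : ℝ => t ^ (-(0 : ℝ)) := by
  simp only [neg_zero, Real.rpow_zero]
  have h : Tendsto (bosonKernel z) (𝓝[>] 0) (𝓝 (bosonKernel z 0)) :=
    ((continuousOn_bosonKernel hre) 0 Set.self_mem_Ici).mono_left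
      (nhdsWithin_mono _ Set.Ioi_subset_Ici_self)
  exact h.isBigO_one ℝ

lemma locallyIntegrableOn_bosonKernel (hre : z.re < 1) :
    MeasureTheory.LocallyIntegrableOn (bosonKernel z) (Set.Ioi 0) :=
  ((continuousOn_bosonKernel hre).mono Set.Ioi_subset_Ici_self).locallyIntegrableOn
    measurableSet_Ioi

lemma continuousAt_mellin_bosonKernel (hz : ‖z‖ = 1) (hre : z.re < 1) :
    ContinuousAt (mellin (bosonKernel z)) 1 :=
  (mellin_differentiableAt_of_isBigO_rpow_exp one_pos (locallyIntegrableOn_bosonKernel hre)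
    (bosonKernel_isBigO_atTop hz) (bosonKernel_isBigO_zero hre) (by simp)).continuousAt

/-- At s = 1 the Mellin weight is 1, and log(1 - z exp(-t)) is a primitive that tends to 0 at
infinity. -/
lemma mellin_bosonKernel_one (hz : ‖z‖ = 1) (hre : z.re < 1) :
    mellin (bosonKernel z) 1 = -Complex.log (1 - z) := by
  have hint : MeasureTheory.IntegrableOn (bosonKernel z) (Set.Ioi 0) := by
    have := mellinConvergent_of_isBigO_rpow_exp (s := 1) one_pos
      (locallyIntegrableOn_bosonKernel hre)
      (bosonKernel_isBigO_atTop hz) (bosonKernel_isBigO_zero hre) (by simp)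
    simpa [MellinConvergent] using this
  have hlim : Tendsto (fun t : ℝ => Complex.log (1 - z * Complex.exp (-t))) atTop (𝓝 0) := by
    have h1 : Tendsto (fun t : ℝ => z * Complex.exp (-t)) atTop (𝓝 0) := by
      rw [tendsto_zero_iff_norm_tendsto_zero]
      simp only [norm_mul_exp_neg_le hz]
      exact Real.tendsto_exp_neg_atTop_nhds_zero
    have h2 := (h1.const_sub 1).clog (by simp)
    simpa using h2
  have := MeasureTheory.integral_Ioi_of_hasDerivAt_of_tendsto
    (hasDerivAt_log_one_sub hre le_rfl).continuousAt.continuousWithinAt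
    (fun t ht => hasDerivAt_log_one_sub hre (le_of_lt ht)) hint hlim
  simpa [mellin] using this

end


lemma norm_exp_two_pi (x : ℝ) : ‖Complex.exp (2 * Real.pi * Complex.I * x)‖ = 1 := by
  rw [show 2 * (Real.pi : ℂ) * Complex.I * x = (2 * Real.pi * x : ℝ) * Complex.I by
      push_cast; ring, Complex.norm_exp_ofReal_mul_I]

/-- The kernel is the geometric series ∑ zⁿ exp(-nt) over n ≥ 1, integrated term by term. The
coefficient at n = 0 is set to 0 because exp(-0·t) has no decay. -/
lemma Gamma_mul_expZeta_eq_mellin (x : ℝ) {s : ℂ} (hs : 1 < s.re) :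
    Complex.Gamma s * expZeta x s =
      mellin (bosonKernel (Complex.exp (2 * Real.pi * Complex.I * x))) s := by
  set z := Complex.exp (2 * Real.pi * Complex.I * x) with hz
  have hz1 : ‖z‖ = 1 := norm_exp_two_pi x
  clear_value z
  have hs0 : s ≠ 0 := by rintro rfl; simp at hs; linarith
  have h := hasSum_mellin (a := fun n : ℕ => if n = 0 then 0 else z ^ n) (p := fun n : ℕ => (n : ℝ))
    (F := bosonKernel z) (s := s) (fun n => ?_) (by linarith) (fun t ht => ?_) ?_
  · refine HasSum.unique ?_ h
    refine ((hasSum_expZeta_of_one_lt_re x hs).mul_left (Complex.Gamma s)).congr_fun fun n => ?_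
    rcases eq_or_ne n 0 with rfl | hn
    · simp [hs0]
    · rw [if_neg hn, hz, ← Complex.exp_nat_mul, Complex.ofReal_natCast, mul_div_assoc,
        mul_comm (n : ℂ)]
  · rcases eq_or_ne n 0 with rfl | hn
    · simp
    · exact Or.inr (by positivity)
  · have hlt : ‖z * Complex.exp (-t)‖ < 1 := by
      rw [norm_mul_exp_neg_le hz1]
      exact Real.exp_lt_one_iff.2 (by simpa using ht)
    have h1 := (hasSum_geometric_of_norm_lt_one hlt).mul_left (z * Complex.exp (-t))
    rw [← hasSum_nat_add_iff' 1]
    rw [bosonKernel, div_eq_mul_inv]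
    simp only [Finset.range_one, Finset.sum_singleton, if_true, zero_mul, sub_zero]
    refine h1.congr_fun fun n => ?_
    rw [if_neg n.succ_ne_zero, ← pow_succ', mul_pow, ← Complex.exp_nat_mul]
    push_cast
    congr 2
    ring
  · refine .of_nonneg_of_le (fun n => by positivity) (fun n => ?_)
      (Real.summable_one_div_nat_rpow.2 hs)
    gcongr
    split_ifs
    · simp
    · simp [hz1]

lemma norm_one_sub_exp_sq (x : ℝ) :
    ‖1 - Complex.exp (2 * Real.pi * Complex.I * x)‖ ^ 2 = (2 * Real.sin (Real.pi * x)) ^ 2 := by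
  rw [show 2 * (Real.pi : ℂ) * Complex.I * x = (2 * (Real.pi * x) : ℝ) * Complex.I by
      push_cast; ring, ← Complex.normSq_eq_norm_sq, Complex.normSq_apply, Complex.sub_re,
      Complex.sub_im, Complex.exp_ofReal_mul_I_re, Complex.exp_ofReal_mul_I_im, Complex.one_re,
      Complex.one_im, Real.sin_two_mul, Real.cos_two_mul]
  linear_combination (4 - 4 * Real.cos (Real.pi * x) ^ 2) *
      (-Real.sin_sq_add_cos_sq (Real.pi * x))

lemma coe_unitAddCircle_ne_zero {x : ℝ} (h0 : 0 < x) (h1 : x < 1) : (x : UnitAddCircle) ≠ 0 := by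
  intro h
  have := (AddCircle.coe_eq_coe_iff_of_mem_Ico (p := (1 : ℝ)) (a := 0) (x := x) (y := 0)
    (by constructor <;> linarith) (by constructor <;> linarith)).1 (by simpa using h)
  linarith

lemma exp_re_lt_one {x : ℝ} (h0 : 0 < x) (h1 : x < 1) :
    (Complex.exp (2 * Real.pi * Complex.I * x)).re < 1 := by
  rw [show 2 * (Real.pi : ℂ) * Complex.I * x = (2 * (Real.pi * x) : ℝ) * Complex.I by
      push_cast; ring, Complex.exp_ofReal_mul_I_re, Real.cos_two_mul]
  nlinarith [sin_pi_mul_pos h0 h1, Real.sin_sq_add_cos_sq (Real.pi * x)]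

/-- The Mellin identity holds for real s > 1 and both sides are continuous at 1, so it passes to the
limit from the right. -/
lemma expZeta_one {x : ℝ} (hx : (x : UnitAddCircle) ≠ 0)
    (hre : (Complex.exp (2 * Real.pi * Complex.I * x)).re < 1) :
    expZeta x 1 = -Complex.log (1 - Complex.exp (2 * Real.pi * Complex.I * x)) := by
  rw [← mellin_bosonKernel_one (norm_exp_two_pi x) hre]
  have hlim : Tendsto (fun r : ℝ => (r : ℂ)) (𝓝[>] 1) (𝓝 1) :=
    (Complex.continuous_ofReal.tendsto' 1 1 (by simp)).mono_left nhdsWithin_le_nhds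
  have h1 := (continuousAt_mellin_bosonKernel (norm_exp_two_pi x) hre).tendsto.comp hlim
  have hG : ContinuousAt (fun s => Complex.Gamma s * expZeta x s) 1 :=
    ((Complex.differentiableAt_Gamma 1 fun m h => by
      have := congrArg Complex.re h
      simp at this
      linarith [(Nat.cast_nonneg m : (0 : ℝ) ≤ m)]).mul
      (differentiable_expZeta_of_ne_zero hx 1)).continuousAt
  have h2 := hG.tendsto.comp hlim
  rw [Complex.Gamma_one, one_mul] at h2
  refine tendsto_nhds_unique h2 (h1.congr' ?_)
  filter_upwards [self_mem_nhdsWithin] with r hr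
  exact (Gamma_mul_expZeta_eq_mellin x (by simpa using hr)).symm

/-- The points x and -x give complex conjugate values, whose mean is -log ‖1 - z‖ with ‖1 - z‖ = 2
sin πx. -/
lemma cosZeta_one {x : ℝ} (h0 : 0 < x) (h1 : x < 1) :
    cosZeta x 1 = clausen 0 x := by
  have hx := coe_unitAddCircle_ne_zero h0 h1
  have hre := exp_re_lt_one h0 h1
  have hconj : Complex.exp (2 * Real.pi * Complex.I * (-x : ℝ)) =
      starRingEnd ℂ (Complex.exp (2 * Real.pi * Complex.I * x)) := by
    rw [← Complex.exp_conj]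
    simp only [map_mul, map_ofNat, Complex.conj_ofReal, Complex.conj_I, Complex.ofReal_neg]
    ring_nf
  have h2 : expZeta (-(x : UnitAddCircle)) 1 = -Complex.log (1 - starRingEnd ℂ
      (Complex.exp (2 * Real.pi * Complex.I * x))) := by
    rw [← hconj, ← AddCircle.coe_neg]
    refine expZeta_one (by simpa using hx) ?_
    rw [hconj, Complex.conj_re]
    exact hre
  rw [cosZeta_eq, expZeta_one hx hre, h2]
  set z := Complex.exp (2 * Real.pi * Complex.I * x) with hz
  have harg : (1 - z).arg ≠ Real.pi := by
    rw [ne_eq, Complex.arg_eq_pi_iff]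
    rintro ⟨h, -⟩
    rw [Complex.sub_re, Complex.one_re] at h
    linarith
  rw [show 1 - starRingEnd ℂ z = starRingEnd ℂ (1 - z) by simp, Complex.log_conj _ harg,
    ← neg_add, Complex.add_conj, Complex.log_re, clausen_zero]
  have hs := sin_pi_mul_pos h0 h1
  have hn : ‖1 - z‖ = 2 * Real.sin (Real.pi * x) :=
    (pow_left_inj₀ (norm_nonneg _) (by positivity) two_ne_zero).1 (norm_one_sub_exp_sq x)
  rw [hn]
  push_cast
  ring

/-! ### Cosine and sine zeta functions at integers in terms of C_N -/

lemma cos_sub_pi_mul_even (m : ℕ) (t : ℝ) :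
    Real.cos (t - Real.pi * (2 * m : ℕ) / 2) = (-1) ^ m * Real.cos t := by
  rw [show t - Real.pi * (2 * m : ℕ) / 2 = t - m * Real.pi by push_cast; ring,
    Real.cos_sub_nat_mul_pi]

lemma cos_sub_pi_mul_odd (m : ℕ) (t : ℝ) :
    Real.cos (t - Real.pi * (2 * m + 1 : ℕ) / 2) = (-1) ^ m * Real.sin t := by
  rw [show t - Real.pi * (2 * m + 1 : ℕ) / 2 = t - m * Real.pi - Real.pi / 2 by push_cast; ring,
    Real.cos_sub_pi_div_two, Real.sin_sub_nat_mul_pi]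

lemma neg_one_pow_mul_self (m : ℕ) : ((-1 : ℝ) ^ m) * (-1) ^ m = 1 := by
  rw [← mul_pow]; simp

lemma cosZeta_eq_clausen {m : ℕ} (hm : m ≠ 0) (x : ℝ) :
    cosZeta x (2 * m + 1) = ((-1) ^ m * (2 * Real.pi) ^ (2 * m) * clausen (2 * m) x : ℝ) := by
  have hre : 1 < (2 * (m : ℂ) + 1).re := by
    have : (0 : ℝ) < m := by positivity
    simpa using this
  refine (hasSum_nat_cosZeta x hre).unique ?_
  have h := ((summable_clausen (N := 2 * m) (by omega) x).hasSum.mul_left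
    ((-1) ^ m * (2 * Real.pi) ^ (2 * m)))
  rw [clausen, if_neg (by omega)]
  refine (Complex.hasSum_ofReal.2 h).congr_fun fun n => ?_
  rw [show (2 * (m : ℂ) + 1) = ((2 * m + 1 : ℕ) : ℂ) by push_cast; ring, Complex.cpow_natCast,
    cos_sub_pi_mul_even, ← Complex.ofReal_natCast n, ← Complex.ofReal_pow, ← Complex.ofReal_div]
  congr 1
  have h2 : (2 * Real.pi) ^ (2 * m) ≠ 0 := by positivity
  rw [show 2 * Real.pi * x * n = 2 * Real.pi * n * x by ring,
    mul_div_assoc' _ _ ((2 * Real.pi) ^ (2 * m) * (n : ℝ) ^ (2 * m + 1)),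
    show ∀ a b c : ℝ, a * b * (a * c) = b * ((a * a) * c) by intros; ring,
    neg_one_pow_mul_self, one_mul, mul_div_mul_left _ _ h2]

lemma sinZeta_eq_clausen (m : ℕ) (x : ℝ) :
    sinZeta x (2 * m + 2) =
      ((-1) ^ m * (2 * Real.pi) ^ (2 * m + 1) * clausen (2 * m + 1) x : ℝ) := by
  have hre : 1 < (2 * (m : ℂ) + 2).re := by
    have : (0 : ℝ) ≤ m := by positivity
    simp
    linarith
  refine (hasSum_nat_sinZeta x hre).unique ?_
  have h := ((summable_clausen (N := 2 * m + 1) (by omega) x).hasSum.mul_left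
    ((-1) ^ m * (2 * Real.pi) ^ (2 * m + 1)))
  rw [clausen, if_neg (by omega)]
  refine (Complex.hasSum_ofReal.2 h).congr_fun fun n => ?_
  rw [show (2 * (m : ℂ) + 2) = ((2 * m + 1 + 1 : ℕ) : ℂ) by push_cast; ring, Complex.cpow_natCast,
    cos_sub_pi_mul_odd, ← Complex.ofReal_natCast n, ← Complex.ofReal_pow, ← Complex.ofReal_div]
  congr 1
  have h2 : (2 * Real.pi) ^ (2 * m + 1) ≠ 0 := by positivity
  rw [show 2 * Real.pi * x * n = 2 * Real.pi * n * x by ring,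
    mul_div_assoc' _ _ ((2 * Real.pi) ^ (2 * m + 1) * (n : ℝ) ^ (2 * m + 1 + 1)),
    show ∀ a b c : ℝ, a * b * (a * c) = b * ((a * a) * c) by intros; ring,
    neg_one_pow_mul_self, one_mul, mul_div_mul_left _ _ h2]

lemma cosZeta_odd_eq_clausen (m : ℕ) {x : ℝ} (h0 : 0 < x) (h1 : x < 1) :
    cosZeta x (2 * m + 1) = ((-1) ^ m * (2 * Real.pi) ^ (2 * m) * clausen (2 * m) x : ℝ) := by
  rcases eq_or_ne m 0 with rfl | hm
  · simpa using cosZeta_one h0 h1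
  · exact cosZeta_eq_clausen hm x

/-! ### The coefficients as zeta values and derivatives of zeta -/

lemma riemannZeta_eq_evenZeta (k : ℕ) : riemannZeta (2 * ((k + 1 : ℕ) : ℂ)) = evenZeta k := by
  have hre : 1 < (2 * ((k + 1 : ℕ) : ℂ)).re := by
    have : (0 : ℝ) ≤ k := by positivity
    simp
    linarith
  rw [zeta_eq_tsum_one_div_nat_add_one_cpow hre, evenZeta, Complex.ofReal_tsum]
  refine tsum_congr fun n => ?_
  rw [show 2 * ((k + 1 : ℕ) : ℂ) = ((2 * k + 2 : ℕ) : ℂ) by push_cast; ring, Complex.cpow_natCast]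
  push_cast
  ring

/-- In the functional equation for ζ(1 - s) the factor cos(πs/2) vanishes at s = 2k+1, so only the
term that differentiates the cosine survives. -/
lemma deriv_riemannZeta_neg_even {k : ℕ} (hk : k ≠ 0) :
    deriv riemannZeta (-(2 * (k : ℂ))) =
      (-1) ^ k * ((2 * k)! : ℂ) / (2 * (2 * Real.pi) ^ (2 * k)) * riemannZeta (2 * k + 1) := by
  have hpi : (Real.pi : ℂ) ≠ 0 := Complex.ofReal_ne_zero.2 Real.pi_ne_zero
  set s : ℂ := 2 * k + 1 with hs
  have hre : 1 < s.re := by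
    have : (0 : ℝ) < k := by positivity
    simpa [hs] using this
  have hopen : IsOpen {s : ℂ | 1 < s.re} := isOpen_lt continuous_const Complex.continuous_re
  have hne : ∀ w : ℂ, 1 < w.re → (∀ n : ℕ, w ≠ -n) := by
    rintro w hw n rfl
    simp at hw
    linarith [(Nat.cast_nonneg n : (0 : ℝ) ≤ n)]
  have hne1 : ∀ w : ℂ, 1 < w.re → w ≠ 1 := by
    rintro w hw rfl
    simp at hw
  have hev : (fun s => riemannZeta (1 - s)) =ᶠ[𝓝 s] fun s =>
      (2 * (2 * Real.pi) ^ (-s) * Complex.Gamma s * riemannZeta s) *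
        Complex.cos (Real.pi * s / 2) := by
    filter_upwards [hopen.mem_nhds hre] with w hw
    rw [riemannZeta_one_sub (hne w hw) (hne1 w hw)]
    ring
  have harg : (Real.pi : ℂ) * s / 2 = k * Real.pi + Real.pi / 2 := by
    rw [hs]; ring
  have hcos : Complex.cos (Real.pi * s / 2) = 0 := by
    rw [harg, Complex.cos_add_pi_div_two, Complex.sin_nat_mul_pi, neg_zero]
  have hsin : Complex.sin (Real.pi * s / 2) = (-1) ^ k := by
    rw [harg, Complex.sin_add_pi_div_two]
    exact_mod_cast congrArg Complex.ofReal (Real.cos_nat_mul_pi k)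
  have hA : DifferentiableAt ℂ
      (fun s => 2 * (2 * Real.pi : ℂ) ^ (-s) * Complex.Gamma s * riemannZeta s) s := by
    refine ((DifferentiableAt.const_mul ?_ _).mul
      (Complex.differentiableAt_Gamma s (hne s hre))).mul (differentiableAt_riemannZeta (hne1 s hre))
    exact differentiableAt_id.neg.const_cpow (Or.inl (by simp [hpi]))
  have hC : HasDerivAt (fun s : ℂ => Complex.cos (Real.pi * s / 2))
      (-Complex.sin (Real.pi * s / 2) * (Real.pi / 2)) s := by
    have := ((hasDerivAt_id s).const_mul (Real.pi : ℂ)).div_const 2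
    simpa using this.ccos
  have hR := (hA.hasDerivAt.mul hC).congr_of_eventuallyEq hev
  have hL : HasDerivAt (fun s => riemannZeta (1 - s)) (-deriv riemannZeta (1 - s)) s := by
    have hd : DifferentiableAt ℂ riemannZeta (1 - s) := by
      apply differentiableAt_riemannZeta
      intro h
      rw [sub_eq_self] at h
      rw [h] at hre
      simp at hre
      linarith
    simpa using hd.hasDerivAt.comp_const_sub 1 s
  have h := hL.unique hR
  rw [hcos, hsin, mul_zero, zero_add] at h
  have h1s : 1 - s = -(2 * (k : ℂ)) := by rw [hs]; ring
  have hpow : (2 * Real.pi : ℂ) ^ (-s) = 1 / (2 * Real.pi) ^ (2 * k + 1) := by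
    rw [hs, Complex.cpow_neg, show (2 * (k : ℂ) + 1) = ((2 * k + 1 : ℕ) : ℂ) by push_cast; ring,
      Complex.cpow_natCast, one_div]
  have hGam : Complex.Gamma s = ((2 * k)! : ℂ) := by
    rw [hs, ← Complex.Gamma_nat_eq_factorial]
    push_cast
    rfl
  rw [h1s, hpow, hGam] at h
  rw [← neg_inj, h, pow_succ]
  field_simp

/-- For k = 0 this is ζ'(0) = -log(2π)/2. For k ≥ 1 both sides are the same multiple of ζ(2k+1). -/
lemma clausenConst_even (k : ℕ) :
    (clausenConst (2 * k) : ℂ) * ((2 * k)! : ℂ) = 2 * deriv riemannZeta (-(2 * (k : ℂ))) := by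
  rcases eq_or_ne k 0 with rfl | hk
  · have h2 : Complex.log (2 * Real.pi) = (Real.log (2 * Real.pi) : ℝ) := by
      rw [Complex.ofReal_log (by positivity)]
      push_cast
      rfl
    simp only [clausenConst, Nat.cast_zero, mul_zero, neg_zero, deriv_riemannZeta_zero, if_true, h2]
    push_cast
    simp
    ring
  · have hpi : (Real.pi : ℂ) ≠ 0 := Complex.ofReal_ne_zero.2 Real.pi_ne_zero
    have h := cosZeta_eq_clausen hk 0
    rw [AddCircle.coe_zero, cosZeta_zero] at h
    rw [deriv_riemannZeta_neg_even hk, h, clausenConst, if_neg (by omega)]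
    push_cast
    have h1 : ((-1 : ℂ) ^ k) * (-1) ^ k = 1 := by rw [← mul_pow]; simp
    field_simp
    linear_combination (-(((2 * k)! : ℂ) * (clausen (2 * k) 0 : ℂ))) * h1

lemma clausenConst_odd (k : ℕ) : clausenConst (2 * k + 1) = 0 := by
  rw [clausenConst, if_neg (by omega), clausen, if_neg (by omega)]
  simp only [cos_sub_pi_mul_odd]
  simp

lemma sum_range_eq_sum_even {M : Type*} [AddCommMonoid M] (f : ℕ → M)
    (hf : ∀ k, f (2 * k + 1) = 0) (m : ℕ) :
    ∑ j ∈ Finset.range (2 * m), f j = ∑ k ∈ Finset.range m, f (2 * k) := by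
  induction m with
  | zero => simp
  | succ m ih =>
    rw [Finset.sum_range_succ, ← ih, mul_add_one, Finset.sum_range_succ, Finset.sum_range_succ, hf,
      add_zero]

lemma polyPart_term_mul_factorial {N k : ℕ} (hk : 2 * k ≤ N) (x : ℝ) :
    ((clausenConst (2 * k) * (x ^ (N - 2 * k) / ((N - 2 * k)! : ℝ)) : ℝ) : ℂ) * (N ! : ℂ) =
      2 * ((N.choose (2 * k) : ℂ) * deriv riemannZeta (-(2 * (k : ℂ))) * (x : ℂ) ^ (N - 2 * k)) := by
  have h := clausenConst_even k
  have hc : (N ! : ℂ) = N.choose (2 * k) * (2 * k)! * (N - 2 * k)! := by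
    exact_mod_cast (Nat.choose_mul_factorial_mul_factorial hk).symm
  have : (((N - 2 * k)! : ℕ) : ℂ) ≠ 0 := Nat.cast_ne_zero.2 (Nat.factorial_ne_zero _)
  rw [hc]
  push_cast
  field_simp
  linear_combination ((N.choose (2 * k) : ℂ) * (x : ℂ) ^ (N - 2 * k)) * h

lemma hasSum_zetaCoeff (N : ℕ) {x : ℝ} (h0 : 0 < x) (h1 : x < 1) :
    HasSum (fun k : ℕ+ => zetaCoeff N k * (x : ℂ) ^ (N + 2 * (k : ℕ)))
      (seriesPart N x * (N ! : ℂ)) := by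
  have h := (Complex.hasSum_ofReal.2 (summable_seriesPart N
    (by rwa [abs_of_pos h0])).hasSum).mul_right (N ! : ℂ)
  rw [← Equiv.pnatEquivNat.symm.hasSum_iff]
  refine h.congr_fun fun k => ?_
  simp only [Function.comp_apply, Equiv.pnatEquivNat_symm_apply, Nat.succPNat_coe, zetaCoeff,
    Nat.succ_eq_add_one, riemannZeta_eq_evenZeta]
  rw [show 2 * (k + 1) - 1 = 2 * k + 1 by omega, show N + 2 * (k + 1) = 2 * k + 2 + N by ring]
  push_cast
  ring

lemma harmonicSum_eq (N : ℕ) : harmonicSum N = ((∑ j ∈ Finset.Icc 1 N, 1 / (j : ℝ) : ℝ) : ℂ) := by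
  simp [harmonicSum]

/-- The constant term, the one with ζ'(-2m), is kept apart from the sum: it is killed by the
character sum for even χ and feeds ζ(2m+1) back at x = 1/2. -/
lemma clausen_even_mul_factorial (m : ℕ) {x : ℝ} (h0 : 0 < x) (h1 : x < 1) :
    (clausen (2 * m) x : ℂ) * ((2 * m)! : ℂ) =
      (x : ℂ) ^ (2 * m) * (harmonicSum (2 * m) - Real.log x) +
      2 * ∑ k ∈ Finset.range m, ((2 * m).choose (2 * k) : ℂ) *
        deriv riemannZeta (-(2 * (k : ℂ))) * (x : ℂ) ^ (2 * m - 2 * k) +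
      2 * deriv riemannZeta (-(2 * (m : ℂ))) +
      2 * ∑' k : ℕ+, zetaCoeff (2 * m) k * (x : ℂ) ^ (2 * m + 2 * (k : ℕ)) := by
  have hf : (((2 * m)! : ℕ) : ℂ) ≠ 0 := Nat.cast_ne_zero.2 (Nat.factorial_ne_zero _)
  have hp : (polyPart (2 * m) x : ℂ) * ((2 * m)! : ℂ) =
      2 * ∑ k ∈ Finset.range m, ((2 * m).choose (2 * k) : ℂ) *
        deriv riemannZeta (-(2 * (k : ℂ))) * (x : ℂ) ^ (2 * m - 2 * k) +
      2 * deriv riemannZeta (-(2 * (m : ℂ))) := by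
    rw [polyPart, Finset.sum_range_succ, sum_range_eq_sum_even _ fun k => by
      rw [clausenConst_odd, zero_mul], Complex.ofReal_add, add_mul,
      polyPart_term_mul_factorial le_rfl, Complex.ofReal_sum, Finset.sum_mul, Finset.mul_sum]
    congr 1
    · refine Finset.sum_congr rfl fun k hk => polyPart_term_mul_factorial ?_ x
      have := Finset.mem_range.1 hk
      omega
    · simp
  rw [(hasSum_zetaCoeff (2 * m) h0 h1).tsum_eq, clausen_eq (2 * m) h0 h1, harmonicSum_eq,
    Complex.ofReal_add, Complex.ofReal_add, add_mul, add_mul, hp, logPart]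
  push_cast
  field_simp
  ring

lemma clausen_odd_mul_factorial (m : ℕ) {x : ℝ} (h0 : 0 < x) (h1 : x < 1) :
    (clausen (2 * m + 1) x : ℂ) * ((2 * m + 1)! : ℂ) =
      (x : ℂ) ^ (2 * m + 1) * (harmonicSum (2 * m + 1) - Real.log x) +
      2 * ∑ k ∈ Finset.range (m + 1), ((2 * m + 1).choose (2 * k) : ℂ) *
        deriv riemannZeta (-(2 * (k : ℂ))) * (x : ℂ) ^ (2 * m + 1 - 2 * k) +
      2 * ∑' k : ℕ+, zetaCoeff (2 * m + 1) k * (x : ℂ) ^ (2 * m + 1 + 2 * (k : ℕ)) := by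
  have hf : (((2 * m + 1)! : ℕ) : ℂ) ≠ 0 := Nat.cast_ne_zero.2 (Nat.factorial_ne_zero _)
  have hp : (polyPart (2 * m + 1) x : ℂ) * ((2 * m + 1)! : ℂ) =
      2 * ∑ k ∈ Finset.range (m + 1), ((2 * m + 1).choose (2 * k) : ℂ) *
        deriv riemannZeta (-(2 * (k : ℂ))) * (x : ℂ) ^ (2 * m + 1 - 2 * k) := by
    rw [polyPart, show 2 * m + 1 + 1 = 2 * (m + 1) by ring, sum_range_eq_sum_even _ fun k => by
      rw [clausenConst_odd, zero_mul], Complex.ofReal_sum, Finset.sum_mul, Finset.mul_sum]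
    refine Finset.sum_congr rfl fun k hk => polyPart_term_mul_factorial ?_ x
    have := Finset.mem_range.1 hk
    omega
  rw [(hasSum_zetaCoeff (2 * m + 1) h0 h1).tsum_eq, clausen_eq (2 * m + 1) h0 h1, harmonicSum_eq,
    Complex.ofReal_add, Complex.ofReal_add, add_mul, add_mul, hp, logPart]
  push_cast
  field_simp

/-! ### Dirichlet characters: L-values as finite sums over a/q -/

section
variable {q : ℕ}

lemma dirichletCharacter_zero {χ : DirichletCharacter ℂ q} (hq : 2 ≤ q) : χ 0 = 0 := by
  have : Fact (1 < q) := ⟨hq⟩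
  exact MulChar.map_zero χ

lemma isPrimitive_inv {χ : DirichletCharacter ℂ q} (hχ : χ.IsPrimitive) : χ⁻¹.IsPrimitive := by
  rwa [DirichletCharacter.isPrimitive_def, DirichletCharacter.conductor_inv]

lemma sum_conj_mul_div_pow (χ : DirichletCharacter ℂ q) (n : ℕ) :
    ∑ a ∈ Finset.Ico 1 q, starRingEnd ℂ (χ (a : ZMod q)) * ((a / q : ℝ) : ℂ) ^ n =
      (q : ℂ) ^ (-(n : ℤ)) * conjPowerSum χ n := by
  rw [conjPowerSum, Finset.mul_sum]
  refine Finset.sum_congr rfl fun a _ => ?_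
  rw [zpow_neg, zpow_natCast]
  push_cast
  rw [div_pow]
  ring

lemma sum_conj_mul_poly (χ : DirichletCharacter ℂ q) (N m : ℕ) (c : ℕ → ℂ) :
    ∑ a ∈ Finset.Ico 1 q, starRingEnd ℂ (χ (a : ZMod q)) *
      ∑ k ∈ Finset.range m, c k * ((a / q : ℝ) : ℂ) ^ (N - 2 * k) =
      ∑ k ∈ Finset.range m, c k *
        ((q : ℂ) ^ (-((N - 2 * k : ℕ) : ℤ)) * conjPowerSum χ (N - 2 * k)) := by
  simp only [← sum_conj_mul_div_pow, Finset.mul_sum]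
  rw [Finset.sum_comm]
  exact Finset.sum_congr rfl fun k _ => Finset.sum_congr rfl fun a _ => by ring

variable [NeZero q]

lemma ne_one_of_isPrimitive {χ : DirichletCharacter ℂ q} (hq : 2 ≤ q) (hχ : χ.IsPrimitive) :
    χ ≠ 1 := by
  rintro rfl
  rw [DirichletCharacter.isPrimitive_def, DirichletCharacter.conductor_one] at hχ
  omega

lemma sum_zmod_eq_sum_Ico (f : ZMod q → ℂ) (hf : f 0 = 0) :
    ∑ j, f j = ∑ a ∈ Finset.Ico 1 q, f (a : ZMod q) := by
  have h : ∑ j, f j = ∑ a ∈ Finset.range q, f (a : ZMod q) := by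
    refine Finset.sum_bij' (fun j _ => j.val) (fun a _ => (a : ZMod q))
      (fun j _ => Finset.mem_range.2 (ZMod.val_lt j)) (fun a _ => Finset.mem_univ _)
      (fun j _ => ZMod.natCast_zmod_val j)
      (fun a ha => ZMod.val_natCast_of_lt (Finset.mem_range.1 ha)) (fun j _ => ?_)
    rw [ZMod.natCast_zmod_val]
  rw [h, Finset.range_eq_Ico, Finset.sum_eq_sum_Ico_succ_bot (NeZero.pos q), Nat.cast_zero, hf,
    zero_add]

open scoped ZMod in
lemma dft_inv {χ : DirichletCharacter ℂ q} (hχ : χ.IsPrimitive) (k : ZMod q) :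
    𝓕 (χ⁻¹ : DirichletCharacter ℂ q) k = χ (-1) * conjGaussSum χ * χ k := by
  rw [(isPrimitive_inv hχ).fourierTransform_eq_inv_mul_gaussSum, inv_inv, ← neg_one_mul k, map_mul,
    conjGaussSum, MulChar.star_eq_inv]
  ring

/-- Were it zero, the Fourier transform of χ⁻¹ would vanish, and by injectivity so would χ⁻¹,
contradicting its value 1 at 1. -/
lemma conjGaussSum_ne_zero {χ : DirichletCharacter ℂ q} (hχ : χ.IsPrimitive) :
    conjGaussSum χ ≠ 0 := by
  intro h
  have h0 : ZMod.dft (χ⁻¹ : DirichletCharacter ℂ q) = 0 := by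
    funext k
    rw [dft_inv hχ, h]
    simp
  have h1 : ((χ⁻¹ : DirichletCharacter ℂ q) : ZMod q → ℂ) = 0 := by
    simpa using h0
  have := congrFun h1 1
  simp at this

/-- The L-function of the Fourier transform of χ⁻¹ is computed in two ways. The factor χ(-1) arises
in both, once from the transform and once from replacing j by -j, and cancels. -/
lemma conjGaussSum_mul_LFunction {χ : DirichletCharacter ℂ q} (hq : 2 ≤ q) (hχ : χ.IsPrimitive)
    (s : ℂ) :
    conjGaussSum χ * χ.LFunction s = ∑ j : ZMod q, χ⁻¹ j * expZeta (ZMod.toAddCircle j) s := by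
  have h := ZMod.LFunction_dft (χ⁻¹ : DirichletCharacter ℂ q) (s := s)
    (Or.inl (dirichletCharacter_zero hq))
  have h1 : ZMod.LFunction (ZMod.dft (χ⁻¹ : DirichletCharacter ℂ q)) s =
      χ (-1) * conjGaussSum χ * χ.LFunction s := by
    rw [DirichletCharacter.LFunction, ZMod.LFunction, ZMod.LFunction, mul_left_comm,
      Finset.mul_sum (a := χ (-1) * conjGaussSum χ)]
    simp only [dft_inv hχ, mul_assoc]
  have h2 : ∑ j : ZMod q, χ⁻¹ j * expZeta (ZMod.toAddCircle (-j)) s =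
      χ (-1) * ∑ j : ZMod q, χ⁻¹ j * expZeta (ZMod.toAddCircle j) s := by
    rw [Finset.mul_sum]
    refine Fintype.sum_equiv (.neg _) _ _ fun j => ?_
    have hneg : χ (-1) * χ⁻¹ (-1) = 1 := by
      rw [← MulChar.mul_apply, mul_inv_cancel, MulChar.one_apply isUnit_one.neg]
    rw [Equiv.neg_apply, ← neg_one_mul j, map_mul (χ⁻¹)]
    linear_combination (-(χ⁻¹ j * expZeta (ZMod.toAddCircle (-1 * j)) s)) * hneg
  rw [h1, h2, mul_assoc] at h
  refine mul_left_cancel₀ ?_ h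
  exact (isUnit_one.neg.map χ).ne_zero

lemma conjGaussSum_mul_LFunction_even {χ : DirichletCharacter ℂ q} (hq : 2 ≤ q)
    (hχ : χ.IsPrimitive) (he : χ.Even) (s : ℂ) :
    conjGaussSum χ * χ.LFunction s =
      ∑ a ∈ Finset.Ico 1 q, starRingEnd ℂ (χ (a : ZMod q)) * cosZeta ((a / q : ℝ)) s := by
  have he' : (χ⁻¹ : DirichletCharacter ℂ q).Even := by
    rw [DirichletCharacter.Even, ← MulChar.star_apply', he]
    simp
  have hodd : ∑ j : ZMod q, χ⁻¹ j * sinZeta (ZMod.toAddCircle j) s = 0 :=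
    (he'.to_fun.mul_odd fun j => by rw [map_neg, sinZeta_neg]).sum_eq_zero
  have h : ∑ j : ZMod q, χ⁻¹ j * expZeta (ZMod.toAddCircle j) s =
      ∑ j : ZMod q, χ⁻¹ j * cosZeta (ZMod.toAddCircle j) s := by
    simp only [expZeta, mul_add, mul_left_comm _ Complex.I, Finset.sum_add_distrib,
      ← Finset.mul_sum, hodd, mul_zero, add_zero]
  rw [conjGaussSum_mul_LFunction hq hχ, h,
    sum_zmod_eq_sum_Ico _ (by rw [dirichletCharacter_zero hq, zero_mul])]
  refine Finset.sum_congr rfl fun a _ => ?_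
  rw [ZMod.toAddCircle_natCast, ← MulChar.star_apply', RCLike.star_def]

lemma conjGaussSum_mul_LFunction_odd {χ : DirichletCharacter ℂ q} (hq : 2 ≤ q)
    (hχ : χ.IsPrimitive) (ho : χ.Odd) (s : ℂ) :
    conjGaussSum χ * χ.LFunction s = Complex.I *
      ∑ a ∈ Finset.Ico 1 q, starRingEnd ℂ (χ (a : ZMod q)) * sinZeta ((a / q : ℝ)) s := by
  have ho' : (χ⁻¹ : DirichletCharacter ℂ q).Odd := by
    rw [DirichletCharacter.Odd, ← MulChar.star_apply', ho]
    simp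
  have heven : ∑ j : ZMod q, χ⁻¹ j * cosZeta (ZMod.toAddCircle j) s = 0 :=
    (ho'.to_fun.mul_even fun j => by rw [map_neg, cosZeta_neg]).sum_eq_zero
  have h : ∑ j : ZMod q, χ⁻¹ j * expZeta (ZMod.toAddCircle j) s =
      Complex.I * ∑ j : ZMod q, χ⁻¹ j * sinZeta (ZMod.toAddCircle j) s := by
    simp only [expZeta, mul_add, mul_left_comm _ Complex.I, Finset.sum_add_distrib,
      ← Finset.mul_sum, heven, zero_add]
  rw [conjGaussSum_mul_LFunction hq hχ, h,
    sum_zmod_eq_sum_Ico _ (by rw [dirichletCharacter_zero hq, zero_mul])]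
  congr 1
  refine Finset.sum_congr rfl fun a _ => ?_
  rw [ZMod.toAddCircle_natCast, ← MulChar.star_apply', RCLike.star_def]

lemma conjPowerSum_zero {χ : DirichletCharacter ℂ q} (hq : 2 ≤ q) (hχ : χ.IsPrimitive) :
    ∑ a ∈ Finset.Ico 1 q, starRingEnd ℂ (χ (a : ZMod q)) = 0 := by
  have h := MulChar.sum_eq_zero_of_ne_one (ne_one_of_isPrimitive hq (isPrimitive_inv hχ))
  rw [sum_zmod_eq_sum_Ico _ (dirichletCharacter_zero hq)] at h
  rw [← h]
  refine Finset.sum_congr rfl fun a _ => ?_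
  rw [← MulChar.star_apply', RCLike.star_def]

lemma sum_conj_mul_logPart (χ : DirichletCharacter ℂ q) (n : ℕ) (H : ℂ) :
    ∑ a ∈ Finset.Ico 1 q, starRingEnd ℂ (χ (a : ZMod q)) *
      (((a / q : ℝ) : ℂ) ^ n * (H - (Real.log (a / q : ℝ) : ℂ))) =
      (q : ℂ) ^ (-(n : ℤ)) *
        ((H + (Real.log q : ℂ)) * conjPowerSum χ n - conjLogPowerSum χ n) := by
  rw [conjPowerSum, conjLogPowerSum, Finset.mul_sum, ← Finset.sum_sub_distrib, Finset.mul_sum]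
  refine Finset.sum_congr rfl fun a ha => ?_
  have ha0 : (a : ℝ) ≠ 0 := Nat.cast_ne_zero.2 (by have := Finset.mem_Ico.1 ha; omega)
  rw [zpow_neg, zpow_natCast, Real.log_div ha0 (NeZero.ne _)]
  push_cast
  rw [div_pow]
  ring

lemma div_pos_lt_one {a : ℕ} (ha : a ∈ Finset.Ico 1 q) : 0 < (a / q : ℝ) ∧ (a / q : ℝ) < 1 := by
  obtain ⟨h1, h2⟩ := Finset.mem_Ico.1 ha
  have hq : (0 : ℝ) < q := Nat.cast_pos.2 (NeZero.pos q)
  exact ⟨div_pos (by exact_mod_cast h1) hq, (div_lt_one hq).2 (by exact_mod_cast h2)⟩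

lemma hasSum_zetaCoeff_mul_conjPowerSum (χ : DirichletCharacter ℂ q) (N : ℕ) :
    HasSum (fun k : ℕ+ => zetaCoeff N k * (q : ℂ) ^ (-((N + 2 * (k : ℕ) : ℕ) : ℤ)) *
        conjPowerSum χ (N + 2 * k))
      (∑ a ∈ Finset.Ico 1 q, starRingEnd ℂ (χ (a : ZMod q)) *
        ∑' k : ℕ+, zetaCoeff N k * ((a / q : ℝ) : ℂ) ^ (N + 2 * (k : ℕ))) := by
  have h := hasSum_sum (s := Finset.Ico 1 q) fun a ha =>
    ((hasSum_zetaCoeff N (div_pos_lt_one ha).1 (div_pos_lt_one ha).2).summable.hasSum).mul_left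
      (starRingEnd ℂ (χ (a : ZMod q)))
  refine h.congr_fun fun k => ?_
  rw [mul_assoc, ← sum_conj_mul_div_pow, Finset.mul_sum]
  exact Finset.sum_congr rfl fun a _ => by ring

lemma sum_conj_mul_clausen_even {χ : DirichletCharacter ℂ q} (hq : 2 ≤ q) (hχ : χ.IsPrimitive)
    (m : ℕ) :
    (∑ a ∈ Finset.Ico 1 q, starRingEnd ℂ (χ (a : ZMod q)) * (clausen (2 * m) (a / q) : ℂ)) *
        ((2 * m)! : ℂ) =
      (q : ℂ) ^ (-((2 * m : ℕ) : ℤ)) *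
          ((harmonicSum (2 * m) + (Real.log q : ℂ)) * conjPowerSum χ (2 * m) -
            conjLogPowerSum χ (2 * m)) +
        2 * ∑ k ∈ Finset.range m, ((2 * m).choose (2 * k) : ℂ) *
          deriv riemannZeta (-(2 * (k : ℂ))) *
          ((q : ℂ) ^ (-((2 * m - 2 * k : ℕ) : ℤ)) * conjPowerSum χ (2 * m - 2 * k)) +
        2 * ∑' k : ℕ+, zetaCoeff (2 * m) k * (q : ℂ) ^ (-((2 * m + 2 * (k : ℕ) : ℕ) : ℤ)) *
          conjPowerSum χ (2 * m + 2 * k) := by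
  rw [(hasSum_zetaCoeff_mul_conjPowerSum χ (2 * m)).tsum_eq, ← sum_conj_mul_logPart,
    ← sum_conj_mul_poly χ (2 * m) m fun k =>
      ((2 * m).choose (2 * k) : ℂ) * deriv riemannZeta (-(2 * (k : ℂ)))]
  -- A multiple of ∑ χ̄(a) = 0 is inserted to match the constant term with ζ'(-2m) in each summand.
  have h0 := congrArg (· * (2 * deriv riemannZeta (-(2 * (m : ℂ))))) (conjPowerSum_zero hq hχ)
  simp only [zero_mul, Finset.sum_mul] at h0
  rw [← add_zero (2 * ∑ a ∈ Finset.Ico 1 q, starRingEnd ℂ (χ (a : ZMod q)) *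
    ∑ k ∈ Finset.range m, _), ← h0]
  simp only [Finset.mul_sum (s := Finset.Ico 1 q), Finset.sum_mul (s := Finset.Ico 1 q),
    ← Finset.sum_add_distrib]
  refine Finset.sum_congr rfl fun a ha => ?_
  rw [mul_assoc, clausen_even_mul_factorial m (div_pos_lt_one ha).1 (div_pos_lt_one ha).2]
  ring

lemma sum_conj_mul_clausen_odd (χ : DirichletCharacter ℂ q) (m : ℕ) :
    (∑ a ∈ Finset.Ico 1 q, starRingEnd ℂ (χ (a : ZMod q)) * (clausen (2 * m + 1) (a / q) : ℂ)) *
        ((2 * m + 1)! : ℂ) =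
      (q : ℂ) ^ (-((2 * m + 1 : ℕ) : ℤ)) *
          ((harmonicSum (2 * m + 1) + (Real.log q : ℂ)) * conjPowerSum χ (2 * m + 1) -
            conjLogPowerSum χ (2 * m + 1)) +
        2 * ∑ k ∈ Finset.range (m + 1), ((2 * m + 1).choose (2 * k) : ℂ) *
          deriv riemannZeta (-(2 * (k : ℂ))) *
          ((q : ℂ) ^ (-((2 * m + 1 - 2 * k : ℕ) : ℤ)) * conjPowerSum χ (2 * m + 1 - 2 * k)) +
        2 * ∑' k : ℕ+, zetaCoeff (2 * m + 1) k *
          (q : ℂ) ^ (-((2 * m + 1 + 2 * (k : ℕ) : ℕ) : ℤ)) *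
          conjPowerSum χ (2 * m + 1 + 2 * k) := by
  rw [(hasSum_zetaCoeff_mul_conjPowerSum χ (2 * m + 1)).tsum_eq, ← sum_conj_mul_logPart,
    ← sum_conj_mul_poly χ (2 * m + 1) (m + 1) fun k =>
      ((2 * m + 1).choose (2 * k) : ℂ) * deriv riemannZeta (-(2 * (k : ℂ)))]
  simp only [Finset.mul_sum (s := Finset.Ico 1 q), Finset.sum_mul (s := Finset.Ico 1 q),
    ← Finset.sum_add_distrib]
  refine Finset.sum_congr rfl fun a ha => ?_
  rw [mul_assoc, clausen_odd_mul_factorial m (div_pos_lt_one ha).1 (div_pos_lt_one ha).2]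
  ring

end

/-! ### The point x = 1/2 and the odd zeta values -/

lemma cosZeta_one_half {m : ℕ} (hm : m ≠ 0) :
    cosZeta ((1 / 2 : ℝ)) (2 * m + 1) =
      ((2 : ℂ) ^ (-(2 * (m : ℤ))) - 1) * riemannZeta (2 * m + 1) := by
  have hre : 1 < (2 * (m : ℂ) + 1).re := by
    have : (0 : ℝ) < m := by positivity
    simpa using this
  have hc := hasSum_nat_cosZeta (1 / 2) hre
  have h0 := hasSum_nat_cosZeta 0 hre
  rw [AddCircle.coe_zero, cosZeta_zero] at h0
  have hs : (2 * (m : ℂ) + 1) = ((2 * m + 1 : ℕ) : ℂ) := by push_cast; ring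
  -- Adding the series of ζ to the alternating one cancels the odd terms and doubles the even ones;
  -- 2 · 2^(-(2m+1)) = 2^(-2m).
  have he : HasSum (fun n : ℕ => ((Real.cos (2 * Real.pi * (1 / 2 : ℝ) * (2 * n : ℕ)) : ℝ) : ℂ) /
      ((2 * n : ℕ) : ℂ) ^ (2 * (m : ℂ) + 1) + ((Real.cos (2 * Real.pi * 0 * (2 * n : ℕ)) : ℝ) : ℂ) /
      ((2 * n : ℕ) : ℂ) ^ (2 * (m : ℂ) + 1))
      ((2 : ℂ) ^ (-(2 * (m : ℤ))) * riemannZeta (2 * m + 1)) := by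
    refine (h0.mul_left ((2 : ℂ) ^ (-(2 * (m : ℤ))))).congr_fun fun n => ?_
    have : 2 * Real.pi * (1 / 2 : ℝ) * (2 * n : ℕ) = n * (2 * Real.pi) := by push_cast; ring
    rw [this, Real.cos_nat_mul_two_pi, hs, Complex.cpow_natCast, Complex.cpow_natCast, zpow_neg,
      show 2 * (m : ℤ) = ((2 * m : ℕ) : ℤ) by push_cast; ring, zpow_natCast]
    simp only [mul_zero, zero_mul, Real.cos_zero, Complex.ofReal_one]
    push_cast
    rw [mul_pow, pow_succ 2]
    field_simp
    norm_num
  have ho : HasSum (fun n : ℕ =>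
      ((Real.cos (2 * Real.pi * (1 / 2 : ℝ) * (2 * n + 1 : ℕ)) : ℝ) : ℂ) /
      ((2 * n + 1 : ℕ) : ℂ) ^ (2 * (m : ℂ) + 1) +
      ((Real.cos (2 * Real.pi * 0 * (2 * n + 1 : ℕ)) : ℝ) : ℂ) /
      ((2 * n + 1 : ℕ) : ℂ) ^ (2 * (m : ℂ) + 1)) 0 := by
    refine hasSum_zero.congr_fun fun n => ?_
    have : 2 * Real.pi * (1 / 2 : ℝ) * (2 * n + 1 : ℕ) = n * (2 * Real.pi) + Real.pi := by
      push_cast; ring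
    rw [this, Real.cos_nat_mul_two_pi_add_pi]
    simp only [mul_zero, zero_mul, Real.cos_zero]
    push_cast
    ring
  have h := (hc.add h0).unique (HasSum.even_add_odd he ho)
  linear_combination h

lemma hasSum_zetaCoeff_two_zpow (m : ℕ) :
    HasSum (fun k : ℕ+ => zetaCoeff (2 * m) k * (2 : ℂ) ^ (-(2 * (k : ℤ))))
      ((2 : ℂ) ^ (2 * m) * ∑' k : ℕ+, zetaCoeff (2 * m) k *
        ((1 / 2 : ℝ) : ℂ) ^ (2 * m + 2 * (k : ℕ))) := by
  have h := (hasSum_zetaCoeff (2 * m) (x := 1 / 2) (by norm_num) (by norm_num)).summable.hasSum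
  refine (h.mul_left ((2 : ℂ) ^ (2 * m))).congr_fun fun k => ?_
  rw [zpow_neg, show 2 * ((k : ℕ) : ℤ) = ((2 * (k : ℕ) : ℕ) : ℤ) by push_cast; ring, zpow_natCast]
  push_cast
  rw [div_pow, pow_add, one_pow]
  field_simp
  ring

lemma two_zpow_sub_two_ne_zero (m : ℕ) : (2 : ℂ) ^ (-(2 * (m : ℤ))) - 2 ≠ 0 := by
  intro h
  have h1 : (2 : ℂ) ^ (-(2 * (m : ℤ))) = 2 ^ (1 : ℤ) := by rw [zpow_one]; linear_combination h
  have h2 : (2 : ℝ) ^ (-(2 * (m : ℤ))) = 2 ^ (1 : ℤ) := by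
    simpa only [norm_zpow, Complex.norm_ofNat] using congrArg norm h1
  have := zpow_right_injective₀ (by norm_num : (0 : ℝ) < 2) (by norm_num) h2
  omega

lemma riemannZeta_odd_eq {m : ℕ} (hm : 1 ≤ m) :
    riemannZeta (2 * (m : ℂ) + 1) =
      (-1) ^ m * (Real.pi : ℂ) ^ (2 * m) * (Real.log 2 : ℂ) /
          (((2 : ℂ) ^ (-(2 * (m : ℤ))) - 2) * ((2 * m)! : ℂ))
        + (-1) ^ m * 2 * (Real.pi : ℂ) ^ (2 * m) /
            (((2 * m)! : ℂ) * ((2 : ℂ) ^ (-(2 * (m : ℤ))) - 2)) *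
          ((1 / 2) * harmonicSum (2 * m)
            + ∑ k ∈ Finset.range m, (2 : ℂ) ^ (2 * k) * ((2 * m).choose (2 * k) : ℂ) *
                deriv riemannZeta (-(2 * (k : ℂ)))
            + ∑' k : ℕ+, zetaCoeff (2 * m) k * (2 : ℂ) ^ (-(2 * (k : ℤ)))) := by
  have hm0 : m ≠ 0 := by omega
  have hpi : (Real.pi : ℂ) ≠ 0 := Complex.ofReal_ne_zero.2 Real.pi_ne_zero
  have hf : (((2 * m)! : ℕ) : ℂ) ≠ 0 := Nat.cast_ne_zero.2 (Nat.factorial_ne_zero _)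
  have hz := two_zpow_sub_two_ne_zero m
  have hcos := cosZeta_one_half hm0
  rw [cosZeta_eq_clausen hm0] at hcos
  have hcl := clausen_even_mul_factorial m (x := 1 / 2) (by norm_num) (by norm_num)
  have hser := (hasSum_zetaCoeff_two_zpow m).tsum_eq
  have hlog : Real.log (1 / 2) = -Real.log 2 := by rw [one_div, Real.log_inv]
  have hsum : (2 : ℂ) ^ (2 * m) * ∑ k ∈ Finset.range m, ((2 * m).choose (2 * k) : ℂ) *
        deriv riemannZeta (-(2 * (k : ℂ))) * ((1 / 2 : ℝ) : ℂ) ^ (2 * m - 2 * k) =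
      ∑ k ∈ Finset.range m, (2 : ℂ) ^ (2 * k) * ((2 * m).choose (2 * k) : ℂ) *
                deriv riemannZeta (-(2 * (k : ℂ))) := by
    rw [Finset.mul_sum]
    refine Finset.sum_congr rfl fun k hk => ?_
    have hk' : 2 * m = (2 * m - 2 * k) + 2 * k := by have := Finset.mem_range.1 hk; omega
    have h2 : (2 : ℂ) ^ (2 * m) * ((1 / 2 : ℝ) : ℂ) ^ (2 * m - 2 * k) = 2 ^ (2 * k) := by
      nth_rewrite 1 [hk']
      push_cast
      rw [div_pow, pow_add]
      field_simp
      simp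
    linear_combination ((2 * m).choose (2 * k) : ℂ) * deriv riemannZeta (-(2 * (k : ℂ))) * h2
  have hhalf : (2 : ℂ) ^ (2 * m) * ((1 / 2 : ℝ) : ℂ) ^ (2 * m) = 1 := by
    rw [← mul_pow]
    norm_num
  have hsign : ((-1 : ℂ) ^ m) * (-1) ^ m = 1 := by rw [← mul_pow]; simp
  rw [deriv_riemannZeta_neg_even hm0, hlog] at hcl
  rw [hser, ← hsum]
  -- With all analytic quantities made atoms, a linear equation for Z remains.
  generalize (∑' k : ℕ+, zetaCoeff (2 * m) k * ((1 / 2 : ℝ) : ℂ) ^ (2 * m + 2 * (k : ℕ))) = A at *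
  generalize (∑ k ∈ Finset.range m, ((2 * m).choose (2 * k) : ℂ) *
        deriv riemannZeta (-(2 * (k : ℂ))) * ((1 / 2 : ℝ) : ℂ) ^ (2 * m - 2 * k)) = B at *
  generalize riemannZeta (2 * (m : ℂ) + 1) = Z at *
  generalize harmonicSum (2 * m) = H at *
  generalize hc : clausen (2 * m) (1 / 2) = c at *
  generalize hw : (2 : ℂ) ^ (-(2 * (m : ℤ))) = w at *
  generalize hu : ((1 / 2 : ℝ) : ℂ) ^ (2 * m) = u at *
  generalize hf' : (((2 * m)! : ℕ) : ℂ) = f at *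
  have hcos' : ((-1) ^ m * (2 ^ (2 * m) * (Real.pi : ℂ) ^ (2 * m)) * c : ℂ) = (w - 1) * Z := by
    rw [← hcos]
    push_cast
    rw [mul_pow]
  rw [mul_pow] at hcl
  push_cast at hcl
  set P := (Real.pi : ℂ) ^ (2 * m) with hP
  set T := (2 : ℂ) ^ (2 * m) with hT
  set e := (-1 : ℂ) ^ m
  have hP0 : P ≠ 0 := pow_ne_zero _ hpi
  have hT0 : T ≠ 0 := pow_ne_zero _ two_ne_zero
  have hcl' : c * f = u * (H + (Real.log 2 : ℂ)) + 2 * B + e * f / (T * P) * Z + 2 * A := by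
    rw [hcl]
    field_simp
    ring
  -- Z enters twice: with w - 1 from the value at 1/2, and with 1 from the term in ζ'(-2m). The
  -- difference is w - 2.
  have key : (w - 2) * f * Z = e * P * (T * u * (H + (Real.log 2 : ℂ)) + 2 * (T * B) + 2 * (T * A)) := by
    have h1 : e * T * P * (c * f) = (w - 1) * Z * f := by
      rw [← hcos']; ring
    have h2 : e * T * P * (e * f / (T * P) * Z) = f * Z := by
      field_simp
      linear_combination Z * hsign
    rw [hcl'] at h1
    linear_combination -h1 + h2
  rw [hhalf] at key
  field_simp
  linear_combination key

/-! ### Assembly of the formulas for L(s, χ) -/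

lemma LFunction_even_eq {q : ℕ} [NeZero q] {χ : DirichletCharacter ℂ q} (m : ℕ) (hq : 2 ≤ q)
    (hχ : χ.IsPrimitive) (he : χ.Even) :
    Summable (fun k : ℕ+ => zetaCoeff (2 * m) k * (q : ℂ) ^ (-(2 * (m : ℤ)) - 2 * (k : ℤ)) *
        conjPowerSum χ (2 * m + 2 * k)) ∧
      DirichletCharacter.LFunction χ (2 * (m : ℂ) + 1) =
        (-1) ^ m * 2 ^ (2 * m) * (Real.pi : ℂ) ^ (2 * m) / (((2 * m)! : ℂ) * conjGaussSum χ) *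
            (q : ℂ) ^ (-(2 * (m : ℤ))) *
            ((Real.log q : ℂ) * conjPowerSum χ (2 * m) - conjLogPowerSum χ (2 * m))
          + (-1) ^ m * 2 ^ (2 * m + 1) * (Real.pi : ℂ) ^ (2 * m) /
              (((2 * m)! : ℂ) * conjGaussSum χ) *
            (∑ k ∈ Finset.range m, (q : ℂ) ^ (2 * (k : ℤ) - 2 * (m : ℤ)) *
                ((2 * m).choose (2 * k) : ℂ) * deriv riemannZeta (-(2 * (k : ℂ))) *
                conjPowerSum χ (2 * m - 2 * k)
              + (q : ℂ) ^ (-(2 * (m : ℤ))) / 2 * harmonicSum (2 * m) * conjPowerSum χ (2 * m)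
              + ∑' k : ℕ+, zetaCoeff (2 * m) k * (q : ℂ) ^ (-(2 * (m : ℤ)) - 2 * (k : ℤ)) *
                  conjPowerSum χ (2 * m + 2 * k)) := by
  have hexp : ∀ k : ℕ+, -(2 * (m : ℤ)) - 2 * (k : ℤ) = -((2 * m + 2 * (k : ℕ) : ℕ) : ℤ) := fun k => by
    push_cast; ring
  simp only [hexp]
  refine ⟨(hasSum_zetaCoeff_mul_conjPowerSum χ (2 * m)).summable, ?_⟩
  have hf : (((2 * m)! : ℕ) : ℂ) ≠ 0 := Nat.cast_ne_zero.2 (Nat.factorial_ne_zero _)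
  have hτ := conjGaussSum_ne_zero hχ
  have hmain := conjGaussSum_mul_LFunction_even hq hχ he (2 * m + 1)
  have hL : conjGaussSum χ * χ.LFunction (2 * (m : ℂ) + 1) = (-1) ^ m * (2 * Real.pi) ^ (2 * m) *
      ∑ a ∈ Finset.Ico 1 q,
        starRingEnd ℂ (χ (a : ZMod q)) * (clausen (2 * m) (a / q) : ℂ) := by
    rw [hmain, Finset.mul_sum]
    refine Finset.sum_congr rfl fun a ha => ?_
    rw [cosZeta_odd_eq_clausen m (div_pos_lt_one ha).1 (div_pos_lt_one ha).2]
    push_cast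
    ring
  have hsum := sum_conj_mul_clausen_even hq hχ m
  have hk : ∑ k ∈ Finset.range m, ((2 * m).choose (2 * k) : ℂ) *
      deriv riemannZeta (-(2 * (k : ℂ))) *
      ((q : ℂ) ^ (-((2 * m - 2 * k : ℕ) : ℤ)) * conjPowerSum χ (2 * m - 2 * k)) =
      ∑ k ∈ Finset.range m, (q : ℂ) ^ (2 * (k : ℤ) - 2 * (m : ℤ)) *
        ((2 * m).choose (2 * k) : ℂ) * deriv riemannZeta (-(2 * (k : ℂ))) *
        conjPowerSum χ (2 * m - 2 * k) := by
    refine Finset.sum_congr rfl fun k hk => ?_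
    rw [show -((2 * m - 2 * k : ℕ) : ℤ) = 2 * (k : ℤ) - 2 * (m : ℤ) by
      have := Finset.mem_range.1 hk; omega]
    ring
  rw [hk, show -((2 * m : ℕ) : ℤ) = -(2 * (m : ℤ)) by push_cast; ring] at hsum
  have hfin := congrArg (fun t : ℂ => (-1) ^ m * (2 * Real.pi : ℂ) ^ (2 * m) * t) hsum
  simp only [← mul_assoc _ _ (((2 * m)! : ℕ) : ℂ), ← hL] at hfin
  rw [mul_pow] at hfin
  rw [pow_succ 2]
  field_simp
  linear_combination hfin

lemma LFunction_odd_eq {q : ℕ} [NeZero q] {χ : DirichletCharacter ℂ q} (m : ℕ) (hq : 2 ≤ q)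
    (hχ : χ.IsPrimitive) (ho : χ.Odd) (hm : 1 ≤ m) :
    Summable (fun k : ℕ+ => zetaCoeff (2 * m - 1) k *
        (q : ℂ) ^ (1 - 2 * (m : ℤ) - 2 * (k : ℤ)) * conjPowerSum χ (2 * m + 2 * k - 1)) ∧
      DirichletCharacter.LFunction χ (2 * (m : ℂ)) =
        Complex.I * (-1) ^ (m + 1) * 2 ^ (2 * m - 1) * (Real.pi : ℂ) ^ (2 * m - 1) /
              (conjGaussSum χ * ((2 * m - 1)! : ℂ)) *
            (q : ℂ) ^ (1 - 2 * (m : ℤ)) *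
            (-conjLogPowerSum χ (2 * m - 1) + (Real.log q : ℂ) * conjPowerSum χ (2 * m - 1))
          + Complex.I * (-1) ^ (m + 1) * 2 ^ (2 * m) * (Real.pi : ℂ) ^ (2 * m - 1) /
              (conjGaussSum χ * ((2 * m - 1)! : ℂ)) *
            (∑ k ∈ Finset.range m, (q : ℂ) ^ (2 * (k : ℤ) + 1 - 2 * (m : ℤ)) *
                conjPowerSum χ (2 * m - 1 - 2 * k) *
                ((2 * m - 1).choose (2 * k) : ℂ) * deriv riemannZeta (-(2 * (k : ℂ)))
              + (q : ℂ) ^ (1 - 2 * (m : ℤ)) / 2 * conjPowerSum χ (2 * m - 1) *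
                  harmonicSum (2 * m - 1)
              + ∑' k : ℕ+, zetaCoeff (2 * m - 1) k *
                  (q : ℂ) ^ (1 - 2 * (m : ℤ) - 2 * (k : ℤ)) *
                  conjPowerSum χ (2 * m + 2 * k - 1)) := by
  -- With m = n + 1 the index 2m - 1 becomes 2n + 1, free of truncated subtraction, and (-1)^(m+1) =
  -- (-1)^n.
  obtain ⟨n, rfl⟩ := Nat.exists_eq_add_of_le' hm
  have hexp : ∀ k : ℕ+, 1 - 2 * ((n + 1 : ℕ) : ℤ) - 2 * (k : ℤ) =
      -((2 * n + 1 + 2 * (k : ℕ) : ℕ) : ℤ) := fun k => by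
    push_cast; ring
  have hexp' : ∀ k : ℕ+, 2 * (n + 1) + 2 * (k : ℕ) - 1 = 2 * n + 1 + 2 * (k : ℕ) := fun k => by omega
  simp only [hexp, hexp', show 2 * (n + 1) - 1 = 2 * n + 1 by omega]
  refine ⟨(hasSum_zetaCoeff_mul_conjPowerSum χ (2 * n + 1)).summable, ?_⟩
  have hf : (((2 * n + 1)! : ℕ) : ℂ) ≠ 0 := Nat.cast_ne_zero.2 (Nat.factorial_ne_zero _)
  have hτ := conjGaussSum_ne_zero hχ
  have hmain := conjGaussSum_mul_LFunction_odd hq hχ ho (2 * n + 2)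
  have hL : conjGaussSum χ * χ.LFunction (2 * (n : ℂ) + 2) =
      Complex.I * ((-1) ^ n * (2 * Real.pi) ^ (2 * n + 1)) *
      ∑ a ∈ Finset.Ico 1 q,
        starRingEnd ℂ (χ (a : ZMod q)) * (clausen (2 * n + 1) (a / q) : ℂ) := by
    rw [hmain, mul_assoc, Finset.mul_sum (a := (-1) ^ n * _)]
    congr 1
    refine Finset.sum_congr rfl fun a _ => ?_
    rw [sinZeta_eq_clausen n]
    push_cast
    ring
  have hsum := sum_conj_mul_clausen_odd χ n
  have hk : ∑ k ∈ Finset.range (n + 1), ((2 * n + 1).choose (2 * k) : ℂ) *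
      deriv riemannZeta (-(2 * (k : ℂ))) *
      ((q : ℂ) ^ (-((2 * n + 1 - 2 * k : ℕ) : ℤ)) * conjPowerSum χ (2 * n + 1 - 2 * k)) =
      ∑ k ∈ Finset.range (n + 1), (q : ℂ) ^ (2 * (k : ℤ) + 1 - 2 * ((n + 1 : ℕ) : ℤ)) *
        conjPowerSum χ (2 * n + 1 - 2 * k) *
        ((2 * n + 1).choose (2 * k) : ℂ) * deriv riemannZeta (-(2 * (k : ℂ))) := by
    refine Finset.sum_congr rfl fun k hk => ?_
    rw [show -((2 * n + 1 - 2 * k : ℕ) : ℤ) = 2 * (k : ℤ) + 1 - 2 * ((n + 1 : ℕ) : ℤ) by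
      have := Finset.mem_range.1 hk; omega]
    ring
  rw [hk, show -((2 * n + 1 : ℕ) : ℤ) = 1 - 2 * ((n + 1 : ℕ) : ℤ) by push_cast; ring] at hsum
  have hfin := congrArg
    (fun t : ℂ => Complex.I * ((-1) ^ n * (2 * Real.pi : ℂ) ^ (2 * n + 1)) * t) hsum
  simp only [← mul_assoc _ _ (((2 * n + 1)! : ℕ) : ℂ), ← hL] at hfin
  rw [mul_pow] at hfin
  rw [show 2 * ((n + 1 : ℕ) : ℂ) = 2 * n + 2 by push_cast; ring,
    show 2 * (n + 1) = 2 * n + 1 + 1 by ring, pow_succ 2 (2 * n + 1), pow_succ (-1) (n + 1),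
    pow_succ (-1) n]
  generalize χ.LFunction (2 * (n : ℂ) + 2) = L at hfin ⊢
  field_simp
  linear_combination hfin

theorem theorem4 :
    -- the zeta values
    (∀ m : ℕ, 1 ≤ m →
      Summable (fun k : ℕ+ => zetaCoeff (2 * m) k * (2 : ℂ) ^ (-(2 * (k : ℤ)))) ∧
      riemannZeta (2 * (m : ℂ) + 1) =
        (-1) ^ m * (Real.pi : ℂ) ^ (2 * m) * (Real.log 2 : ℂ) /
            (((2 : ℂ) ^ (-(2 * (m : ℤ))) - 2) * ((2 * m)! : ℂ))
          + (-1) ^ m * 2 * (Real.pi : ℂ) ^ (2 * m) /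
              (((2 * m)! : ℂ) * ((2 : ℂ) ^ (-(2 * (m : ℤ))) - 2)) *
            ((1 / 2) * harmonicSum (2 * m)
              + ∑ k ∈ Finset.range m, (2 : ℂ) ^ (2 * k) * ((2 * m).choose (2 * k) : ℂ) *
                  deriv riemannZeta (-(2 * (k : ℂ)))
              + ∑' k : ℕ+, zetaCoeff (2 * m) k * (2 : ℂ) ^ (-(2 * (k : ℤ))))) ∧
    -- even primitive characters
    (∀ (q : ℕ) [NeZero q] (χ : DirichletCharacter ℂ q) (m : ℕ),
      2 ≤ q → χ.IsPrimitive → χ.Even →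
      Summable (fun k : ℕ+ => zetaCoeff (2 * m) k * (q : ℂ) ^ (-(2 * (m : ℤ)) - 2 * (k : ℤ)) *
        conjPowerSum χ (2 * m + 2 * k)) ∧
      DirichletCharacter.LFunction χ (2 * (m : ℂ) + 1) =
        (-1) ^ m * 2 ^ (2 * m) * (Real.pi : ℂ) ^ (2 * m) / (((2 * m)! : ℂ) * conjGaussSum χ) *
            (q : ℂ) ^ (-(2 * (m : ℤ))) *
            ((Real.log q : ℂ) * conjPowerSum χ (2 * m) - conjLogPowerSum χ (2 * m))
          + (-1) ^ m * 2 ^ (2 * m + 1) * (Real.pi : ℂ) ^ (2 * m) /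
              (((2 * m)! : ℂ) * conjGaussSum χ) *
            (∑ k ∈ Finset.range m, (q : ℂ) ^ (2 * (k : ℤ) - 2 * (m : ℤ)) *
                ((2 * m).choose (2 * k) : ℂ) * deriv riemannZeta (-(2 * (k : ℂ))) *
                conjPowerSum χ (2 * m - 2 * k)
              + (q : ℂ) ^ (-(2 * (m : ℤ))) / 2 * harmonicSum (2 * m) * conjPowerSum χ (2 * m)
              + ∑' k : ℕ+, zetaCoeff (2 * m) k * (q : ℂ) ^ (-(2 * (m : ℤ)) - 2 * (k : ℤ)) *
                  conjPowerSum χ (2 * m + 2 * k))) ∧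
    -- odd primitive characters
    (∀ (q : ℕ) [NeZero q] (χ : DirichletCharacter ℂ q) (m : ℕ),
      2 ≤ q → χ.IsPrimitive → χ.Odd → 1 ≤ m →
      Summable (fun k : ℕ+ => zetaCoeff (2 * m - 1) k *
        (q : ℂ) ^ (1 - 2 * (m : ℤ) - 2 * (k : ℤ)) * conjPowerSum χ (2 * m + 2 * k - 1)) ∧
      DirichletCharacter.LFunction χ (2 * (m : ℂ)) =
        Complex.I * (-1) ^ (m + 1) * 2 ^ (2 * m - 1) * (Real.pi : ℂ) ^ (2 * m - 1) /
              (conjGaussSum χ * ((2 * m - 1)! : ℂ)) *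
            (q : ℂ) ^ (1 - 2 * (m : ℤ)) *
            (-conjLogPowerSum χ (2 * m - 1) + (Real.log q : ℂ) * conjPowerSum χ (2 * m - 1))
          + Complex.I * (-1) ^ (m + 1) * 2 ^ (2 * m) * (Real.pi : ℂ) ^ (2 * m - 1) /
              (conjGaussSum χ * ((2 * m - 1)! : ℂ)) *
            (∑ k ∈ Finset.range m, (q : ℂ) ^ (2 * (k : ℤ) + 1 - 2 * (m : ℤ)) *
                conjPowerSum χ (2 * m - 1 - 2 * k) *
                ((2 * m - 1).choose (2 * k) : ℂ) * deriv riemannZeta (-(2 * (k : ℂ)))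
              + (q : ℂ) ^ (1 - 2 * (m : ℤ)) / 2 * conjPowerSum χ (2 * m - 1) *
                  harmonicSum (2 * m - 1)
              + ∑' k : ℕ+, zetaCoeff (2 * m - 1) k *
                  (q : ℂ) ^ (1 - 2 * (m : ℤ) - 2 * (k : ℤ)) *
                  conjPowerSum χ (2 * m + 2 * k - 1))) := by
  exact ⟨fun m hm => ⟨(hasSum_zetaCoeff_two_zpow m).summable, riemannZeta_odd_eq hm⟩,
    fun q _ χ m hq hχ he => LFunction_even_eq m hq hχ he,
    fun q _ χ m hq hχ ho hm => LFunction_odd_eq m hq hχ ho hm⟩
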